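/- Let $K$ be a field of characteristic zero, $n\geq 2$, $P_i=K[x_1,\ldots ,x_i]$ (so $P_0=K$), and let $\mathfrak{u}_n=K\partial_1+P_1\partial_2+\cdots +P_{n-1}\partial_n$ be the Lie algebra of triangular polynomial derivations of $P_n$, where $\partial_i=\partial/\partial x_i$. It has the $K$-basis $X_{\alpha ,i}=x^\alpha \partial_i$, indexed by the set $\Omega_n$ of the pairs $(\alpha ,i)$ with $1\leq i\leq n$ and $\alpha\in\mathbb{N}^{i-1}$, where $\mathbb{N}=\{0,1,\ldots\}$. The set $\Omega_n$ is well-ordered by: $(\alpha ,i)>(\beta ,j)$ iff $i<j$, or $i=j$ and for some $m$ one has $\alpha_m>\beta_m$ and $\alpha_k=\beta_k$ for all $k>m$. Let $\mathrm{ord}(\Omega_n)$ be the order type of $\Omega_n$, and let $\mathrm{ord}(\alpha ,i)$ be the order type of $\{(\beta ,j)\in\Omega_n : (\beta ,j)\leq (\alpha ,i)\}$. For an ordinal $\lambda\leq \mathrm{ord}(\Omega_n)$ let $$I_\lambda =\bigoplus_{\mathrm{ord}(\alpha ,i)\leq \lambda} KX_{\alpha ,i},$$ which is an ideal of $\mathfrak{u}_n$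 (with $I_0=0$). Let $\omega$ be the first infinite ordinal and $\omega^0=1$; for $i\in\mathbb{N}$, $i\omega^k$ denotes the sum $\omega^k+\cdots +\omega^k$ of $i$ copies of $\omega^k$ (the ordinal product usually written $\omega^k\cdot i$). Then every ideal of $\mathfrak{u}_n$ equals $I_\lambda$ for exactly one ordinal $\lambda$ with $0\leq\lambda\leq\mathrm{ord}(\Omega_n)$, and for all ordinals $\lambda ,\mu\leq \mathrm{ord}(\Omega_n)$ the following hold, where isomorphisms are isomorphisms of Lie algebras over $K$. 1. $\mathfrak{u}_n\simeq \mathfrak{u}_n/I_\lambda$ if and only if $\lambda =i\omega^{n-2}$ for some $i\in\mathbb{N}$. 2. $\mathfrak{u}_n/I_\lambda\simeq \mathfrak{u}_n/I_\mu$ if and only if one of the following holds: (a) $\lambda =i\omega^{n-2}+\nu$ and $\mu =j\omega^{n-2}+\nu$ for some $i,j\in\mathbb{N}$ and some ordinal $\nu$ with $0\leq\nu<\omega^{n-2}$; (b) $\lambda =\omega^{n-1}+\omega^{n-2}+\cdots +\omega^s+i\omega^{s-2}+\nu$ and $\mu =\omega^{n-1}+\omega^{n-2}+\cdots +\omega^s+j\omega^{s-2}+\nu$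 for some integer $s$ with $2\leq s\leq n-1$, some $i,j\in\mathbb{N}$ and some ordinal $\nu$ with $0\leq\nu<\omega^{s-2}$; (c) $\lambda =\mu =\omega^{n-1}+\omega^{n-2}+\cdots +\omega +\varepsilon$ for some $\varepsilon\in\{0,1\}$. -/

import Mathlib

namespace TriDer

/-- The polynomial algebra `P_n = K[x_1, …, x_n]`; the variable `x_{i+1}` is `X i`, `i : Fin n`. -/
abbrev Poly (K : Type*) [Field K] (n : ℕ) : Type _ := MvPolynomial (Fin n) K

/-- The Lie algebra `Der_K(P_n)` of `K`-derivations of `P_n`. -/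
abbrev Der (K : Type*) [Field K] (n : ℕ) : Type _ := Derivation K (Poly K n) (Poly K n)

/-- The subalgebra of the polynomials in the variables that come strictly before `X i`. -/
noncomputable abbrev lowerPoly (K : Type*) [Field K] (n : ℕ) (i : Fin n) :
    Subalgebra K (Poly K n) :=
  MvPolynomial.supported K {j : Fin n | j < i}

theorem map_lowerPoly {K : Type*} [Field K] {n : ℕ} (D : Der K n)
    (hD : ∀ i, D (MvPolynomial.X i) ∈ lowerPoly K n i) (i : Fin n) (p : Poly K n)
    (hp : p ∈ lowerPoly K n i) : D p ∈ lowerPoly K n i := by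
  have hp' : p ∈ Algebra.adjoin K (MvPolynomial.X '' {j : Fin n | j < i}) := hp
  refine Algebra.adjoin_induction (p := fun q _ => D q ∈ lowerPoly K n i) ?_ ?_ ?_ ?_ hp'
  · rintro _ ⟨j, hj, rfl⟩
    exact MvPolynomial.supported_mono (fun k (hk : k < j) => lt_trans hk hj) (hD j)
  · intro r
    rw [Derivation.map_algebraMap]
    exact zero_mem _
  · intro x y _ _ hx hy
    rw [map_add]
    exact add_mem hx hy
  · intro x y hx' hy' hx hy
    rw [Derivation.leibniz]
    exact add_mem (mul_mem hx' hy) (mul_mem hy' hx)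

/-- The Lie algebra `u_n = K∂_1 + P_1∂_2 + ⋯ + P_{n-1}∂_n` of triangular polynomial derivations:
the derivations whose coefficient at each `∂_i` (that is, whose value at `x_i`) lies
in `P_{i-1}`; see `mem_u_iff`. -/
def u (K : Type*) [Field K] (n : ℕ) : LieSubalgebra K (Der K n) where
  carrier := {D | ∀ i, D (MvPolynomial.X i) ∈ lowerPoly K n i}
  zero_mem' := fun i => by simp
  add_mem' := fun {a b} ha hb i => by
    rw [Derivation.add_apply]; exact add_mem (ha i) (hb i)
  smul_mem' := fun c a ha i => by
    rw [Derivation.smul_apply]; exact Subalgebra.smul_mem _ (ha i) c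
  lie_mem' := fun {a b} ha hb i => by
    rw [Derivation.commutator_apply]
    exact sub_mem (map_lowerPoly a ha i _ (hb i)) (map_lowerPoly b hb i _ (ha i))

theorem sum_smul_pderiv_X {K : Type*} [Field K] {n : ℕ} (p : Fin n → Poly K n) (j : Fin n) :
    (∑ i, p i • (MvPolynomial.pderiv i : Der K n)) (MvPolynomial.X j) = p j := by
  classical
  have h : (∑ i, p i • (MvPolynomial.pderiv i : Der K n)) (MvPolynomial.X j)
      = ∑ i, (p i • (MvPolynomial.pderiv i : Der K n)) (MvPolynomial.X j) := by
    have h' := congrFun (map_sum (Derivation.coeFnAddMonoidHom (R := K) (A := Poly K n)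
      (M := Poly K n)) (fun i => p i • (MvPolynomial.pderiv i : Der K n)) Finset.univ)
      (MvPolynomial.X j)
    rw [Finset.sum_apply] at h'
    exact h'
  rw [h]
  simp [MvPolynomial.pderiv_X, Pi.single_apply]

theorem eq_sum_pderiv {K : Type*} [Field K] {n : ℕ} (D : Der K n) :
    D = ∑ i, D (MvPolynomial.X i) • (MvPolynomial.pderiv i : Der K n) := by
  refine MvPolynomial.derivation_ext fun j => ?_
  rw [sum_smul_pderiv_X]

theorem mem_u_iff {K : Type*} [Field K] {n : ℕ} (D : Der K n) :
    D ∈ u K n ↔ ∃ p : Fin n → Poly K n, (∀ i, p i ∈ lowerPoly K n i) ∧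
      D = ∑ i, p i • (MvPolynomial.pderiv i : Der K n) := by
  constructor
  · intro h
    exact ⟨fun i => D (MvPolynomial.X i), h, eq_sum_pderiv D⟩
  · rintro ⟨p, hp, rfl⟩ j
    rw [sum_smul_pderiv_X]
    exact hp j

/-- The index set `Ω_n` of the canonical basis: pairs `(α, i)` where `α` is an exponent vector that
involves only the variables strictly before the `i`-th one. -/
@[ext]
structure Omega (n : ℕ) where
  idx : Fin n
  exp : Fin n →₀ ℕ
  exp_eq_zero : ∀ k, idx ≤ k → exp k = 0

/-- The order on `Ω_n`: `(α, i) < (β, j)` iff `j < i`, or `i = j` and `α_m < β_m` at the largest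
place `m` where `α` and `β` differ. -/
def Omega.lt {n : ℕ} (a b : Omega n) : Prop :=
  b.idx < a.idx ∨
    (a.idx = b.idx ∧ ∃ m, (∀ k, m < k → a.exp k = b.exp k) ∧ a.exp m < b.exp m)

theorem Omega.lt_iff_lex {n : ℕ} (a b : Omega n) : Omega.lt a b ↔
    Prod.Lex (· > ·) (Pi.Lex (· > ·) (fun {_} => (· < ·)))
      (a.idx, (a.exp : Fin n → ℕ)) (b.idx, (b.exp : Fin n → ℕ)) := by
  rw [Prod.lex_def]
  rfl

instance Omega.isWellOrder (n : ℕ) : IsWellOrder (Omega n) Omega.lt where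
  wf := by
    have h : WellFounded (Prod.Lex (fun i j : Fin n => i > j)
        (Pi.Lex (β := fun _ : Fin n => ℕ) (· > ·) (fun {_} => (· < ·)))) :=
      WellFounded.prod_lex wellFounded_gt (Pi.Lex.wellFounded _ fun _ => wellFounded_lt)
    refine Subrelation.wf ?_
      (InvImage.wf (fun a : Omega n => (a.idx, (a.exp : Fin n → ℕ))) h)
    intro a b hab
    exact (Omega.lt_iff_lex a b).1 hab
  trichotomous := by
    intro a b hab hba
    have hi : a.idx = b.idx :=
      le_antisymm (not_lt.1 fun h => hab (Or.inl h)) (not_lt.1 fun h => hba (Or.inl h))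
    have ht : Std.Trichotomous
        (Pi.Lex (β := fun _ : Fin n => ℕ) (· > ·) (fun {_} => (· < ·))) :=
      Pi.trichotomous_lex _ _ wellFounded_gt
    have he : (a.exp : Fin n → ℕ) = b.exp := by
      refine ht.trichotomous _ _ ?_ ?_
      · exact fun h => hab (Or.inr ⟨hi, h⟩)
      · exact fun h => hba (Or.inr ⟨hi.symm, h⟩)
    exact Omega.ext hi (DFunLike.coe_injective he)

/-- The ordinal `ord (Ω_n)`: the order type of `Ω_n`. -/
noncomputable def ordOmega (n : ℕ) : Ordinal.{0} := Ordinal.type (@Omega.lt n)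

/-- The ordinal `ord (α, i)`: the order type of `{b ∈ Ω_n | b ≤ (α, i)}`, that is, the order type
of the set of the elements strictly below `(α, i)`, plus one. -/
noncomputable def Omega.ord {n : ℕ} (a : Omega n) : Ordinal.{0} :=
  Ordinal.typein Omega.lt a + 1

theorem Omega.ord_le_ord {n : ℕ} {a b : Omega n} (h : Omega.lt a b) : a.ord ≤ b.ord := by
  unfold Omega.ord
  gcongr
  exact ((Ordinal.typein_lt_typein Omega.lt).2 h).le

/-- The element `X_{α, i} = x^α ∂_i` of the canonical basis of `u_n`. -/
noncomputable def basisElt (K : Type*) [Field K] {n : ℕ} (a : Omega n) : u K n :=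
  ⟨MvPolynomial.monomial a.exp (1 : K) • (MvPolynomial.pderiv a.idx : Der K n), by
    classical
    intro j
    rw [Derivation.smul_apply, MvPolynomial.pderiv_X, Pi.single_apply]
    split_ifs with h
    · subst h
      rw [smul_eq_mul, mul_one, MvPolynomial.mem_supported,
        MvPolynomial.vars_monomial one_ne_zero]
      intro k hk
      by_contra hk'
      exact (Finsupp.mem_support_iff.1 hk) (a.exp_eq_zero k (not_lt.1 hk'))
    · simp⟩

theorem span_basisElt (K : Type*) [Field K] (n : ℕ) :
    Submodule.span K (Set.range (basisElt K (n := n))) = ⊤ := by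
  refine (Submodule.map_injective_of_injective
    (f := (u K n).toSubmodule.subtype) Subtype.val_injective) ?_
  rw [Submodule.map_span, Submodule.map_top, Submodule.range_subtype]
  refine le_antisymm ?_ ?_
  · rw [Submodule.span_le]
    rintro _ ⟨x, -, rfl⟩
    exact x.2
  · intro D hD
    rw [eq_sum_pderiv D]
    refine Submodule.sum_mem _ fun i _ => ?_
    have hi : D (MvPolynomial.X i) ∈ lowerPoly K n i := hD i
    rw [MvPolynomial.mem_supported] at hi
    rw [(D (MvPolynomial.X i)).as_sum, Finset.sum_smul]
    refine Submodule.sum_mem _ fun α hα => ?_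
    have hz : ∀ k, i ≤ k → α k = 0 := by
      intro k hk
      by_contra hne
      have hv : k ∈ (D (MvPolynomial.X i)).vars :=
        (MvPolynomial.mem_vars_iff_mem_support k).2 ⟨α, hα, Finsupp.mem_support_iff.2 hne⟩
      exact absurd (hi hv) (not_lt.2 hk)
    have he : (MvPolynomial.monomial α) (MvPolynomial.coeff α (D (MvPolynomial.X i)))
        • (MvPolynomial.pderiv i : Der K n)
        = MvPolynomial.coeff α (D (MvPolynomial.X i)) •
          ((basisElt K ⟨i, α, hz⟩ : u K n) : Der K n) := by
      rw [basisElt, ← smul_assoc, MvPolynomial.smul_monomial, smul_eq_mul, mul_one]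
    rw [he]
    exact Submodule.smul_mem _ _ (Submodule.subset_span ⟨_, ⟨_, rfl⟩, rfl⟩)

theorem basisElt_X (K : Type*) [Field K] {n : ℕ} (a : Omega n) (k : Fin n) :
    (basisElt K a : Der K n) (MvPolynomial.X k) =
      if k = a.idx then MvPolynomial.monomial a.exp (1 : K) else 0 := by
  classical
  rw [basisElt, Derivation.smul_apply, MvPolynomial.pderiv_X, Pi.single_apply]
  by_cases h : a.idx = k
  · simp [h]
  · simp [Ne.symm h]

theorem smul_basisElt_X (K : Type*) [Field K] {n : ℕ} (r : K) (a : Omega n) (k : Fin n) :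
    (r • basisElt K a : u K n).1 (MvPolynomial.X k) =
      if k = a.idx then MvPolynomial.monomial a.exp r else 0 := by
  have h : (r • basisElt K a : u K n).1 (MvPolynomial.X k) =
      r • (basisElt K a : Der K n) (MvPolynomial.X k) := rfl
  rw [h, basisElt_X]
  by_cases hk : k = a.idx
  · rw [if_pos hk, if_pos hk, MvPolynomial.smul_monomial, smul_eq_mul, mul_one]
  · rw [if_neg hk, if_neg hk, smul_zero]

theorem basisElt_monomial (K : Type*) [Field K] {n : ℕ} (a : Omega n) (β : Fin n →₀ ℕ) :
    (basisElt K a : Der K n) (MvPolynomial.monomial β (1 : K)) =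
      MvPolynomial.monomial (a.exp + (β - Finsupp.single a.idx 1)) (β a.idx : K) := by
  rw [basisElt, Derivation.smul_apply, MvPolynomial.pderiv_monomial, smul_eq_mul,
    MvPolynomial.monomial_mul, one_mul, one_mul]

theorem lie_basisElt_X (K : Type*) [Field K] {n : ℕ} (a b : Omega n) (h : a.idx ≤ b.idx)
    (k : Fin n) : (⁅basisElt K a, basisElt K b⁆ : u K n).1 (MvPolynomial.X k) =
      if k = b.idx then MvPolynomial.monomial (a.exp + (b.exp - Finsupp.single a.idx 1))
        (b.exp a.idx : K) else 0 := by
  have h0 : (basisElt K b : Der K n) (MvPolynomial.monomial a.exp (1 : K)) = 0 := by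
    rw [basisElt_monomial, a.exp_eq_zero _ h, Nat.cast_zero, map_zero]
  change (⁅(basisElt K a : Der K n), (basisElt K b : Der K n)⁆) (MvPolynomial.X k) = _
  rw [Derivation.commutator_apply, basisElt_X, basisElt_X]
  have h1 : (basisElt K b : Der K n)
      (if k = a.idx then MvPolynomial.monomial a.exp (1 : K) else 0) = 0 := by
    split_ifs
    · exact h0
    · exact map_zero _
  rw [h1, sub_zero]
  split_ifs
  · exact basisElt_monomial K a b.exp
  · exact map_zero _

/-- `[X_{α, i}, X_{β, j}] = β_i X_{α + β - e_i, j}` for `i < j`. -/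
theorem lie_basisElt_of_lt (K : Type*) [Field K] {n : ℕ} (a b : Omega n) (h : a.idx < b.idx) :
    ⁅basisElt K a, basisElt K b⁆ = 0 ∨
      ∃ c : Omega n, Omega.lt c a ∧ Omega.lt c b ∧
        ⁅basisElt K a, basisElt K b⁆ = (b.exp a.idx : K) • basisElt K c := by
  by_cases hz : b.exp a.idx = 0
  · left
    refine Subtype.ext (MvPolynomial.derivation_ext fun k => ?_)
    rw [lie_basisElt_X K a b h.le, hz, Nat.cast_zero, map_zero, ite_self]
    rfl
  · right
    refine ⟨⟨b.idx, a.exp + (b.exp - Finsupp.single a.idx 1), fun k hk => ?_⟩, Or.inl h,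
      Or.inr ⟨rfl, a.idx, fun k hk => ?_, ?_⟩, ?_⟩
    · simp [a.exp_eq_zero k (h.le.trans hk), b.exp_eq_zero k hk]
    · simp [a.exp_eq_zero k hk.le, hk.ne]
    · simp [a.exp_eq_zero _ le_rfl]
      omega
    · refine Subtype.ext (MvPolynomial.derivation_ext fun k => ?_)
      rw [lie_basisElt_X K a b h.le, smul_basisElt_X]

theorem lie_basisElt_of_eq (K : Type*) [Field K] {n : ℕ} (a b : Omega n) (h : a.idx = b.idx) :
    ⁅basisElt K a, basisElt K b⁆ = 0 := by
  refine Subtype.ext (MvPolynomial.derivation_ext fun k => ?_)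
  rw [lie_basisElt_X K a b h.le, b.exp_eq_zero _ h.ge, Nat.cast_zero, map_zero, ite_self]
  rfl

theorem lie_basisElt (K : Type*) [Field K] {n : ℕ} (a b : Omega n) :
    ⁅basisElt K a, basisElt K b⁆ = 0 ∨
      ∃ (c : Omega n) (r : K), Omega.lt c b ∧
        ⁅basisElt K a, basisElt K b⁆ = r • basisElt K c := by
  rcases lt_trichotomy a.idx b.idx with h | h | h
  · rcases lie_basisElt_of_lt K a b h with h0 | ⟨c, -, hc, he⟩
    · exact Or.inl h0
    · exact Or.inr ⟨c, _, hc, he⟩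
  · exact Or.inl (lie_basisElt_of_eq K a b h)
  · rcases lie_basisElt_of_lt K b a h with h0 | ⟨c, hc, -, he⟩
    · left; rw [← lie_skew, h0, neg_zero]
    · right; exact ⟨c, -(a.exp b.idx : K), hc, by rw [← lie_skew, he, neg_smul]⟩

/-- The ideal `I_λ = ⨁_{ord (α, i) ≤ λ} K X_{α, i}` of `u_n`; in particular `I_0 = 0`. -/
noncomputable def idealI (K : Type*) [Field K] (n : ℕ) (lam : Ordinal.{0}) : LieIdeal K (u K n) where
  __ := Submodule.span K (basisElt K (n := n) '' {a | a.ord ≤ lam})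
  lie_mem := by
    intro x m hm
    change ⁅x, m⁆ ∈ Submodule.span K (basisElt K (n := n) '' {a | a.ord ≤ lam})
    change m ∈ Submodule.span K (basisElt K (n := n) '' {a | a.ord ≤ lam}) at hm
    have hx : x ∈ Submodule.span K (Set.range (basisElt K (n := n))) := by
      rw [span_basisElt]; trivial
    induction hm using Submodule.span_induction with
    | zero => rw [lie_zero]; exact zero_mem _
    | add y z _ _ hy hz => rw [lie_add]; exact add_mem hy hz
    | smul r y _ hy => rw [lie_smul]; exact Submodule.smul_mem _ r hy
    | mem y hy =>
      obtain ⟨b, hb, rfl⟩ := hy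
      induction hx using Submodule.span_induction with
      | zero => rw [zero_lie]; exact zero_mem _
      | add y z _ _ hy hz => rw [add_lie]; exact add_mem hy hz
      | smul r y _ hy => rw [smul_lie]; exact Submodule.smul_mem _ r hy
      | mem y hy =>
        obtain ⟨a, rfl⟩ := hy
        rcases lie_basisElt K a b with h0 | ⟨c, r, hc, he⟩
        · rw [h0]; exact zero_mem _
        · rw [he]
          exact Submodule.smul_mem _ r (Submodule.subset_span
            ⟨c, (Omega.ord_le_ord hc).trans hb, rfl⟩)

/-- The ordinal `ω^{n-1} + ω^{n-2} + ⋯ + ω^s` (decreasing exponents; `0` if `n ≤ s`). -/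
noncomputable def omegaSum (s : ℕ) : ℕ → Ordinal.{0}
  | 0 => 0
  | n + 1 => if s ≤ n then Ordinal.omega0 ^ n + omegaSum s n else 0

end TriDer

/-! ### Ordinal positions in `Omega n` in Cantor normal form. -/

namespace TriDer

open Ordinal

/-! Indices start at 0, so block `i` consists of the `x^α ∂_i` with `α` in `i` variables and has
order type `ω^i`. Blocks of larger index come first; hence `x^α ∂_i` has position `ω^{n-1} + ⋯ +
ω^{i+1}` plus the Cantor normal form with digits `α` (`Omega.typein_eq_pos`).

Ideals. If an ideal contains an element with leading basis element `X_a`, then for every `b < a`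
some bracket moves the leading term to a place `d` with `b ≤ d < a` (`exists_lie_leading`;
characteristic zero keeps its coefficient nonzero). By transfinite induction the ideal contains
everything below `a`, so the ideals form a well-ordered chain (`exists_eq_idealI`).

Isomorphisms. An isomorphism of quotients matches these chains, hence `I_{λ+ρ}` with `I_{μ+ρ}`
(`Corr.add`). The `ρ` with `λ + ρ = ord(Ω_n)` is therefore an invariant; it tells in which block `λ`
lies. Let this be block `i = m + 1`, put `S = ω^{n-1} + ⋯ + ω^{i+1}` and write `λ = S + ω^m k + ν`
with `ν < ω^m`.

The digit `k` is not an invariant: applying `∂/∂x_m` to the coefficient of `∂_i` gives a surjection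
onto `u_n / I_S` with kernel `I_{S+ω^m}`, so a summand `ω^m` may be dropped (`quot_equiv_add`). The
remainder `ν` is one: for `k = 0`, the ideal `I_{S+ω^m+1}`, which ends with `x_m ∂_i`, has an
annihilator modulo `I_{S+ν}` from which `ν` can be read off (`annihilator_eq`, `eq_of_equiv`). -/

/-- The ordinal `ω^{k-1} · d_{k-1} + ⋯ + ω · d_1 + d_0`. -/
noncomputable def digitVal (d : ℕ → ℕ) : ℕ → Ordinal.{0}
  | 0 => 0
  | k + 1 => ω ^ k * (d k : Ordinal.{0}) + digitVal d k

theorem digitVal_lt (d : ℕ → ℕ) (k : ℕ) : digitVal d k < ω ^ k := by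
  induction k with
  | zero => simp [digitVal]
  | succ k ih =>
    rw [digitVal, pow_succ]
    calc ω ^ k * (d k : Ordinal.{0}) + digitVal d k
        < ω ^ k * (d k : Ordinal.{0}) + ω ^ k := by gcongr
      _ = ω ^ k * ((d k + 1 : ℕ) : Ordinal.{0}) := by
          rw [Nat.cast_add, Nat.cast_one, mul_add, mul_one]
      _ ≤ ω ^ k * ω := mul_le_mul_right (natCast_lt_omega0 _).le _

theorem digitVal_congr {d e : ℕ → ℕ} {k : ℕ} (h : ∀ j < k, d j = e j) :
    digitVal d k = digitVal e k := by
  induction k with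
  | zero => rfl
  | succ k ih => rw [digitVal, digitVal, h k k.lt_succ_self, ih fun j hj => h j (by omega)]

theorem digitVal_mono {d e : ℕ → ℕ} {k : ℕ} (h : ∀ j < k, d j ≤ e j) :
    digitVal d k ≤ digitVal e k := by
  induction k with
  | zero => rfl
  | succ k ih =>
    rw [digitVal, digitVal]
    gcongr
    · exact h k k.lt_succ_self
    · exact ih fun j hj => h j (by omega)

theorem exists_digitVal_eq {k : ℕ} {o : Ordinal.{0}} (h : o < ω ^ k) :
    ∃ d : ℕ → ℕ, digitVal d k = o := by
  induction k generalizing o with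
  | zero => exact ⟨0, by simpa [digitVal, eq_comm] using h⟩
  | succ k ih =>
    have hk : (ω : Ordinal.{0}) ^ k ≠ 0 := pow_ne_zero _ omega0_ne_zero
    obtain ⟨d, hd⟩ := ih (mod_lt o hk)
    have hq : o / ω ^ k < ω := by
      rw [← lt_mul_iff_div_lt hk, ← pow_succ]; exact h
    obtain ⟨q, hq⟩ := lt_omega0.1 hq
    refine ⟨fun j => if j = k then q else d j, ?_⟩
    rw [digitVal, digitVal_congr (e := d) fun j hj => if_neg hj.ne, hd, if_pos rfl, ← hq]
    exact div_add_mod _ _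

theorem digitVal_lt_digitVal {d e : ℕ → ℕ} {k m : ℕ} (hm : m < k)
    (h : ∀ j, m < j → j < k → d j = e j) (hlt : d m < e m) : digitVal d k < digitVal e k := by
  induction k with
  | zero => omega
  | succ k ih =>
    rw [digitVal, digitVal]
    rcases (Nat.lt_succ_iff_lt_or_eq.1 hm) with hm' | rfl
    · rw [h k hm' k.lt_succ_self]
      gcongr
      exact ih hm' fun j h1 h2 => h j h1 (by omega)
    · calc ω ^ m * (d m : Ordinal.{0}) + digitVal d m
          < ω ^ m * (d m : Ordinal.{0}) + ω ^ m := by gcongr; exact digitVal_lt _ _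
        _ = ω ^ m * ((d m + 1 : ℕ) : Ordinal.{0}) := by
          rw [Nat.cast_add, Nat.cast_one, mul_add, mul_one]
        _ ≤ ω ^ m * (e m : Ordinal.{0}) := mul_le_mul_right (by exact_mod_cast hlt) _
        _ ≤ _ := le_self_add

theorem omegaSum_of_le {s n : ℕ} (h : n ≤ s) : omegaSum s n = 0 := by
  cases n with
  | zero => rfl
  | succ n => rw [omegaSum, if_neg (by omega)]

/-- The recursion defining `omegaSum` adds the largest power on the left; this form splits off the
smallest power on the right, which is the contribution of block `s`. -/
theorem omegaSum_eq_add {s n : ℕ} (h : s < n) : omegaSum s n = omegaSum (s + 1) n + ω ^ s := by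
  induction n with
  | zero => omega
  | succ n ih =>
    rw [omegaSum, if_pos (by omega), omegaSum]
    split_ifs with h'
    · rw [ih (by omega), add_assoc]
    · obtain rfl : s = n := by omega
      rw [omegaSum_of_le le_rfl, zero_add, add_zero]

theorem omegaSum_add {s m n : ℕ} (h1 : s ≤ m) (h2 : m ≤ n) :
    omegaSum m n + omegaSum s m = omegaSum s n := by
  induction n with
  | zero => obtain rfl : m = 0 := by omega
            simp [omegaSum]
  | succ n ih =>
    rcases h2.lt_or_eq with h2 | rfl
    · rw [omegaSum, if_pos (by omega), add_assoc, ih (by omega), omegaSum, if_pos (by omega)]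
    · rw [omegaSum_of_le le_rfl, zero_add]

theorem omegaSum_anti {s t n : ℕ} (h : s ≤ t) : omegaSum t n ≤ omegaSum s n := by
  rcases le_total t n with ht | ht
  · rw [← omegaSum_add h ht]; exact le_self_add
  · rw [omegaSum_of_le ht]; exact zero_le

/-- The sequence of exponents of `(α, i)`, extended by zero. -/
def Omega.digits {n : ℕ} (a : Omega n) (j : ℕ) : ℕ := if h : j < n then a.exp ⟨j, h⟩ else 0

theorem Omega.digits_val {n : ℕ} (a : Omega n) (j : Fin n) : a.digits j = a.exp j := by
  simp [digits]

/-- The Cantor normal form of the position of `(α, i)` in `Ω_n`. -/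
noncomputable def Omega.pos {n : ℕ} (a : Omega n) : Ordinal.{0} :=
  omegaSum (a.idx + 1) n + digitVal a.digits a.idx

theorem Omega.pos_lt_omegaSum {n : ℕ} (a : Omega n) : a.pos < omegaSum a.idx n := by
  rw [pos, omegaSum_eq_add a.idx.isLt]
  gcongr
  exact digitVal_lt _ _

theorem Omega.omegaSum_le_pos {n : ℕ} (a : Omega n) : omegaSum (a.idx + 1) n ≤ a.pos :=
  le_self_add

theorem Omega.pos_strictMono {n : ℕ} {a b : Omega n} (h : Omega.lt a b) : a.pos < b.pos := by
  rcases h with h | ⟨h, m, hm, hlt⟩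
  · exact a.pos_lt_omegaSum.trans_le ((omegaSum_anti (by omega)).trans b.omegaSum_le_pos)
  · have hmi : m < b.idx := by
      by_contra hmi
      rw [b.exp_eq_zero m (not_lt.1 hmi)] at hlt
      omega
    rw [pos, pos, h]
    gcongr
    refine digitVal_lt_digitVal (m := m) hmi (fun j h1 h2 => ?_) ?_
    · have hj : j < n := h2.trans b.idx.isLt
      simpa [digits, hj] using hm ⟨j, hj⟩ h1
    · rwa [digits_val, digits_val]

/-- The element of `Ω_n` with the given last index and digits. -/
noncomputable def Omega.ofDigits {n : ℕ} (i : Fin n) (d : ℕ → ℕ) : Omega n where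
  idx := i
  exp := Finsupp.equivFunOnFinite.symm fun k => if k < i then d k else 0
  exp_eq_zero := fun k hk => by simp [not_lt.2 hk]

@[simp] theorem Omega.ofDigits_idx {n : ℕ} (i : Fin n) (d : ℕ → ℕ) : (ofDigits i d).idx = i := rfl

@[simp] theorem Omega.ofDigits_exp {n : ℕ} (i : Fin n) (d : ℕ → ℕ) (k : Fin n) :
    (ofDigits i d).exp k = if k < i then d k else 0 := rfl

theorem Omega.ofDigits_pos {n : ℕ} (i : Fin n) (d : ℕ → ℕ) :
    (ofDigits i d).pos = omegaSum (i + 1) n + digitVal d i := by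
  rw [pos]
  congr 1
  refine digitVal_congr fun j hj => ?_
  have hj' : j < n := lt_trans hj i.isLt
  have : (⟨j, hj'⟩ : Fin n) < i := hj
  simp [digits, hj', this]

theorem Omega.exists_pos_eq_of_lt {n : ℕ} (i : Fin n) {r : Ordinal.{0}} (hr : r < ω ^ (i : ℕ)) :
    ∃ a : Omega n, a.idx = i ∧ a.pos = omegaSum (i + 1) n + r := by
  obtain ⟨d, rfl⟩ := exists_digitVal_eq hr
  exact ⟨ofDigits i d, rfl, ofDigits_pos i d⟩

/-- Block `s` fills exactly the interval from `omegaSum (s + 1) n` to `omegaSum s n`, so descending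
through the blocks leaves no gaps. -/
theorem Omega.exists_pos_eq {n s : ℕ} (hs : s ≤ n) {o : Ordinal.{0}} (h : o < omegaSum s n) :
    ∃ a : Omega n, a.pos = o := by
  induction hk : n - s generalizing s with
  | zero => rw [omegaSum_of_le (by omega)] at h; exact absurd h not_lt_zero
  | succ k ih =>
    by_cases ho : o < omegaSum (s + 1) n
    · exact ih (by omega) ho (by omega)
    · obtain ⟨r, rfl⟩ := exists_add_of_le (not_lt.1 ho)
      rw [omegaSum_eq_add (s := s) (by omega), add_lt_add_iff_left] at h
      obtain ⟨a, -, ha⟩ := exists_pos_eq_of_lt (⟨s, by omega⟩ : Fin n) h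
      exact ⟨a, ha⟩

theorem Omega.pos_lt_omegaSum_zero {n : ℕ} (a : Omega n) : a.pos < omegaSum 0 n :=
  a.pos_lt_omegaSum.trans_le (omegaSum_anti (Nat.zero_le _))

/-- The position as an initial segment embedding into the ordinals. -/
noncomputable def Omega.posInitial (n : ℕ) :
    InitialSeg (@Omega.lt n) (fun a b : Ordinal.{0} => a < b) where
  toRelEmbedding := RelEmbedding.ofMonotone Omega.pos fun _ _ => Omega.pos_strictMono
  mem_range_of_rel' := by
    intro a o ho
    obtain ⟨b, hb⟩ := exists_pos_eq (Nat.zero_le n) (lt_trans ho a.pos_lt_omegaSum_zero)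
    exact ⟨b, hb⟩

/-- Initial segment embeddings of a well-order into the ordinals are unique. -/
theorem Omega.typein_eq_pos {n : ℕ} (a : Omega n) : typein Omega.lt a = a.pos :=
  (posInitial n).eq_principalSeg (typein Omega.lt) a

theorem ordOmega_eq (n : ℕ) : ordOmega n = omegaSum 0 n := by
  refine le_antisymm ?_ ?_
  · by_contra h
    obtain ⟨a, ha⟩ := typein_surj Omega.lt (not_le.1 h)
    rw [Omega.typein_eq_pos] at ha
    exact a.pos_lt_omegaSum_zero.ne ha
  · by_contra h
    obtain ⟨a, ha⟩ := Omega.exists_pos_eq (Nat.zero_le n) (not_le.1 h)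
    rw [← Omega.typein_eq_pos] at ha
    exact (typein_lt_type Omega.lt a).ne ha

/-- The `+ 1` in `ord` turns `≤` into `<`: `I_λ` is spanned by the basis elements at positions below
`λ`. -/
theorem Omega.ord_le_iff {n : ℕ} (a : Omega n) (lam : Ordinal.{0}) :
    a.ord ≤ lam ↔ a.pos < lam := by
  rw [ord, typein_eq_pos, Order.add_one_le_iff]

theorem Omega.lt_iff_pos {n : ℕ} (a b : Omega n) : Omega.lt a b ↔ a.pos < b.pos := by
  rw [← typein_eq_pos, ← typein_eq_pos, typein_lt_typein]

theorem Omega.pos_injective (n : ℕ) : Function.Injective (pos (n := n)) := by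
  intro a b h
  rw [← typein_eq_pos, ← typein_eq_pos] at h
  exact typein_injective _ h

theorem Omega.pos_le_of_exp_le {n : ℕ} {a b : Omega n} (h : a.idx = b.idx)
    (he : ∀ k, a.exp k ≤ b.exp k) : a.pos ≤ b.pos := by
  rw [pos, pos, h]
  gcongr
  refine digitVal_mono fun j hj => ?_
  have hj' : j < n := lt_trans hj b.idx.isLt
  simpa [digits, hj'] using he ⟨j, hj'⟩

end TriDer

/-! ### The canonical basis and leading terms of brackets. -/

namespace TriDer

theorem Omega.induction {n : ℕ} {p : Omega n → Prop}
    (h : ∀ a, (∀ b : Omega n, b.pos < a.pos → p b) → p a) (a : Omega n) : p a :=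
  (InvImage.wf Omega.pos (wellFounded_lt (α := Ordinal.{0}))).induction a h

section Basis

variable (K : Type*) [Field K] {n : ℕ}

/-- The coefficient of an element of `u_n` at `x^α ∂_i`. -/
noncomputable def basisCoeff (a : Omega n) : Module.Dual K (u K n) where
  toFun x := MvPolynomial.coeff a.exp (x.1 (MvPolynomial.X a.idx))
  map_add' x y := by
    rw [← MvPolynomial.coeff_add]; rfl
  map_smul' r x := by
    rw [RingHom.id_apply, ← MvPolynomial.coeff_smul]; rfl

theorem basisCoeff_basisElt (a b : Omega n) [Decidable (b = a)] :
    basisCoeff K a (basisElt K b) = if b = a then 1 else 0 := by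
  classical
  change MvPolynomial.coeff a.exp ((basisElt K b : Der K n) (MvPolynomial.X a.idx)) = _
  rw [basisElt_X]
  by_cases h : a.idx = b.idx
  · rw [if_pos h, MvPolynomial.coeff_monomial]
    exact if_congr ⟨fun h' => Omega.ext h.symm h', fun h' => by rw [h']⟩ rfl rfl
  · rw [if_neg h, MvPolynomial.coeff_zero, if_neg fun h' => h (by rw [h'])]

theorem linearIndependent_basisElt : LinearIndependent K (basisElt K (n := n)) := by
  classical
  refine LinearIndependent.of_pairwise_dual_eq_zero_one _ (basisCoeff K) ?_ ?_
  · intro a b hab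
    rw [basisCoeff_basisElt, if_neg hab.symm]
  · intro a
    rw [basisCoeff_basisElt, if_pos rfl]

/-- The canonical basis of `u_n`. -/
noncomputable def uBasis (n : ℕ) : Module.Basis (Omega n) K (u K n) :=
  Module.Basis.mk (linearIndependent_basisElt K) (span_basisElt K n).ge

@[simp] theorem uBasis_apply (a : Omega n) : uBasis K n a = basisElt K a := by
  simp [uBasis]

variable {K}

theorem mem_idealI_iff_mem_span {lam : Ordinal.{0}} {x : u K n} :
    x ∈ idealI K n lam ↔ x ∈ Submodule.span K (basisElt K '' {a : Omega n | a.pos < lam}) := by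
  simp_rw [← Omega.ord_le_iff]; rfl

theorem basisElt_mem_idealI {a : Omega n} {lam : Ordinal.{0}} :
    basisElt K a ∈ idealI K n lam ↔ a.pos < lam := by
  have h := (uBasis K n).self_mem_span_image (i := a) (s := {a : Omega n | a.pos < lam})
  rw [uBasis_apply, funext (uBasis_apply K)] at h
  rw [mem_idealI_iff_mem_span, h]
  rfl

theorem idealI_mono {lam mu : Ordinal.{0}} (h : lam ≤ mu) : idealI K n lam ≤ idealI K n mu := by
  intro x hx
  have hsub : {a : Omega n | a.pos < lam} ⊆ {a : Omega n | a.pos < mu} := by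
    intro a ha
    rw [Set.mem_ofPred_eq] at ha ⊢
    exact ha.trans_le h
  exact mem_idealI_iff_mem_span.2
    (Submodule.span_mono (Set.image_mono hsub) (mem_idealI_iff_mem_span.1 hx))

/-- The basis element at position `mu` separates the two ideals when `mu < lam`. The bound
guarantees that it exists, since `I_λ` stops growing at `ord(Ω_n)`. -/
theorem idealI_le_iff {lam mu : Ordinal.{0}} (hl : lam ≤ ordOmega n) :
    idealI K n lam ≤ idealI K n mu ↔ lam ≤ mu := by
  refine ⟨fun h => ?_, idealI_mono⟩
  by_contra hlt
  obtain ⟨a, ha⟩ := Omega.exists_pos_eq (Nat.zero_le n)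
    ((not_le.1 hlt).trans_le (hl.trans (ordOmega_eq n).le))
  exact lt_irrefl _ ((basisElt_mem_idealI.1 (h (basisElt_mem_idealI.2
    (ha.trans_lt (not_le.1 hlt))))).trans_eq ha.symm)

theorem idealI_injOn {lam mu : Ordinal.{0}} (hl : lam ≤ ordOmega n) (hm : mu ≤ ordOmega n)
    (h : idealI K n lam = idealI K n mu) : lam = mu :=
  le_antisymm ((idealI_le_iff hl).1 h.le) ((idealI_le_iff hm).1 h.ge)

theorem idealI_zero : idealI K n 0 = ⊥ := by
  rw [eq_bot_iff]
  intro x hx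
  rw [mem_idealI_iff_mem_span] at hx
  simpa using hx

end Basis

section Bracket

variable {n : ℕ}

/-- The index of the basis element that `[X_c, X_a]` is a multiple of, for `c.idx ≤ a.idx`. -/
noncomputable def bracketIdx (c a : Omega n) (h : c.idx ≤ a.idx) : Omega n where
  idx := a.idx
  exp := c.exp + (a.exp - Finsupp.single c.idx 1)
  exp_eq_zero k hk := by simp [c.exp_eq_zero k (h.trans hk), a.exp_eq_zero k hk]

theorem lie_basisElt_eq (K : Type*) [Field K] (c a : Omega n) (h : c.idx ≤ a.idx) :
    ⁅basisElt K c, basisElt K a⁆ = (a.exp c.idx : K) • basisElt K (bracketIdx c a h) := by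
  refine Subtype.ext (MvPolynomial.derivation_ext fun k => ?_)
  rw [lie_basisElt_X K c a h, smul_basisElt_X]
  rfl

variable {K : Type*} [Field K]

/-- Bracketing with a fixed `X_c` preserves the order of basis elements wherever the bracket is
nonzero, so terms below the leading one stay below its image. -/
theorem lie_mem_of_lt_right {a a' c : Omega n} (hca : c.idx < a.idx)
    (ha' : Omega.lt a' a) :
    ⁅basisElt K c, basisElt K a'⁆ ∈ idealI K n (bracketIdx c a hca.le).pos := by
  have hca' : c.idx ≤ a'.idx := by
    rcases ha' with h | ⟨h, -⟩
    · exact (hca.trans h).le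
    · exact h ▸ hca.le
  -- The truncated subtraction in `bracketIdx` is a genuine decrement only for a nonzero exponent;
  -- otherwise the bracket vanishes.
  by_cases hz : a'.exp c.idx = 0
  · rw [lie_basisElt_eq K c a' hca', hz, Nat.cast_zero, zero_smul]
    exact zero_mem _
  rw [lie_basisElt_eq K c a' hca']
  refine Submodule.smul_mem _ _ (basisElt_mem_idealI.2 (Omega.pos_strictMono ?_))
  rcases ha' with h | ⟨h, m, hm, hlt⟩
  · exact Or.inl h
  · refine Or.inr ⟨h, m, fun k hk => ?_, ?_⟩
    · simp [bracketIdx, hm k hk]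
    · by_cases hmc : c.idx = m
      · subst hmc
        simp [bracketIdx]
        omega
      · simpa [bracketIdx, hmc] using hlt

theorem lie_mem_of_lt_left {a a' c : Omega n} (hac : a.idx < c.idx)
    (ha' : Omega.lt a' a) :
    ⁅basisElt K a', basisElt K c⁆ ∈ idealI K n (bracketIdx a c hac.le).pos := by
  rcases lt_or_ge c.idx a'.idx with hc | hc
  · rw [← lie_skew, lie_basisElt_eq K c a' hc.le]
    exact neg_mem (Submodule.smul_mem _ _ (basisElt_mem_idealI.2
      (Omega.pos_strictMono (Or.inl hc))))
  by_cases hz : c.exp a'.idx = 0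
  · rw [lie_basisElt_eq K a' c hc, hz, Nat.cast_zero, zero_smul]
    exact zero_mem _
  rw [lie_basisElt_eq K a' c hc]
  refine Submodule.smul_mem _ _ (basisElt_mem_idealI.2 (Omega.pos_strictMono ?_))
  rcases ha' with h | ⟨h, m, hm, hlt⟩
  -- Here `X_{a'}` lowers the exponent of `x_{a'.idx}`, while `X_a` only affects earlier variables,
  -- so this is the highest place of difference.
  · refine Or.inr ⟨rfl, a'.idx, fun k hk => ?_, ?_⟩
    · simp [bracketIdx, a.exp_eq_zero k (h.trans hk).le, a'.exp_eq_zero k hk.le,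
        (h.trans hk).ne, hk.ne]
    · simp [bracketIdx, a.exp_eq_zero _ h.le, a'.exp_eq_zero _ le_rfl, h.ne]
      omega
  · refine Or.inr ⟨rfl, m, fun k hk => ?_, ?_⟩
    · simp [bracketIdx, hm k hk, h]
    · simpa [bracketIdx, h] using hlt

theorem lie_mem_of_forall_basisElt (J : LieIdeal K (u K n)) {x y : u K n} {kap : Ordinal.{0}}
    (h : ∀ a : Omega n, a.pos < kap → ⁅x, basisElt K a⁆ ∈ J) (hy : y ∈ idealI K n kap) :
    ⁅x, y⁆ ∈ J := by
  rw [mem_idealI_iff_mem_span] at hy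
  induction hy using Submodule.span_induction with
  | zero => rw [lie_zero]; exact zero_mem _
  | add y z _ _ hy hz => rw [lie_add]; exact add_mem hy hz
  | smul r y _ hy => rw [lie_smul]; exact J.smul_mem r hy
  | mem y hy =>
    obtain ⟨a, ha, rfl⟩ := hy
    exact h a ha



theorem idealI_le_of_forall_basisElt {J : LieIdeal K (u K n)} {kap : Ordinal.{0}}
    (h : ∀ a : Omega n, a.pos < kap → basisElt K a ∈ J) : idealI K n kap ≤ J := by
  intro z hz
  rw [mem_idealI_iff_mem_span] at hz
  refine (Submodule.span_le (p := J.toSubmodule)).2 ?_ hz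
  rintro _ ⟨b, hb, rfl⟩
  exact h b hb

theorem exists_leading {x : u K n} (hx : x ≠ 0) : ∃ (a : Omega n) (r : K) (y : u K n),
    r ≠ 0 ∧ y ∈ idealI K n a.pos ∧ x = r • basisElt K a + y := by
  classical
  have hx' : (uBasis K n).repr x ≠ 0 := by simpa using hx
  obtain ⟨a, ha, hmax⟩ := ((uBasis K n).repr x).support.exists_max_image Omega.pos
    (Finsupp.support_nonempty_iff.2 hx')
  refine ⟨a, (uBasis K n).repr x a, x - (uBasis K n).repr x a • basisElt K a,
    Finsupp.mem_support_iff.1 ha, ?_, (add_sub_cancel _ _).symm⟩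
  rw [mem_idealI_iff_mem_span, ← funext (uBasis_apply K), (uBasis K n).mem_span_image]
  intro b hb
  rw [Finset.mem_coe, Finsupp.mem_support_iff, map_sub, map_smul, Finsupp.sub_apply,
    Finsupp.smul_apply, Module.Basis.repr_self, Finsupp.single_apply] at hb
  by_cases hab : a = b
  · subst hab
    simp at hb
  · rw [if_neg hab, smul_zero, sub_zero] at hb
    exact (hmax b (Finsupp.mem_support_iff.2 hb)).lt_of_ne
      fun h => hab (Omega.pos_injective n h.symm)

end Bracket

/-! ### Every ideal is some `I_λ`. -/

section Ideals

variable {K : Type*} [Field K] [CharZero K] {n : ℕ}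

/-- If `b` lies in an earlier block, take `X_c = x^b x_{a.idx} ∂_{b.idx}`: bracketing gives a
nonzero multiple of `x^{a+b} ∂_{b.idx}`. In the same block, let `m` be the top place where they
differ and take `c` to be the part of `b` below `m`, with index `m`: the bracket lowers `a_m` by
one, still at least `b_m`, and adds the lower digits of `b`. -/
theorem exists_lie_leading {a b : Omega n} (h : Omega.lt b a) :
    ∃ (c d : Omega n) (r : K), r ≠ 0 ∧ b.pos ≤ d.pos ∧ d.pos < a.pos ∧
      ⁅basisElt K c, basisElt K a⁆ = r • basisElt K d ∧
      ∀ a' : Omega n, Omega.lt a' a → ⁅basisElt K c, basisElt K a'⁆ ∈ idealI K n d.pos := by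
  rcases h with h | ⟨h, m, hm, hlt⟩
  · set c : Omega n := ⟨b.idx, b.exp + Finsupp.single a.idx 1, fun k hk => by
      simp [b.exp_eq_zero k hk, (h.trans_le hk).ne]⟩ with hc
    have h0 : c.exp a.idx ≠ 0 := by simp [hc]
    refine ⟨c, bracketIdx a c h.le, -(c.exp a.idx : K), neg_ne_zero.2 (Nat.cast_ne_zero.2 h0),
      Omega.pos_le_of_exp_le rfl fun k => ?_, Omega.pos_strictMono (Or.inl h), ?_,
      fun a' ha' => ?_⟩
    · simp [bracketIdx, hc]
    · rw [← lie_skew, lie_basisElt_eq K a c h.le, neg_smul]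
    · rw [← lie_skew]
      exact neg_mem (lie_mem_of_lt_left (c := c) h ha')
  · have hma : m < a.idx := by
      by_contra hma
      rw [a.exp_eq_zero m (not_lt.1 hma)] at hlt
      omega
    set c : Omega n := Omega.ofDigits m b.digits with hc
    have h0 : a.exp c.idx ≠ 0 := Nat.ne_zero_of_lt hlt
    have hca : c.idx < a.idx := hma
    refine ⟨c, bracketIdx c a hca.le, (a.exp c.idx : K), Nat.cast_ne_zero.2 h0,
      Omega.pos_le_of_exp_le h fun k => ?_,
      Omega.pos_strictMono (Or.inr ⟨rfl, m, fun k hk => ?_, ?_⟩),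
      lie_basisElt_eq K c a hca.le, fun a' ha' => lie_mem_of_lt_right hca ha'⟩
    · rcases lt_trichotomy k m with hk | rfl | hk
      · simp [bracketIdx, hc, hk, Omega.digits_val]
      · simp [bracketIdx, hc]
        omega
      · simp [bracketIdx, hc, hk.not_gt, hk.ne, hm k hk]
    · simp [bracketIdx, hc, hk.not_gt, hk.ne]
    · simp [bracketIdx, hc]
      omega

/-- Transfinite induction on the leading position: for each `b < a` a bracket produces an element of
`J` with leading place `d`, `b ≤ d < a`, to which the induction hypothesis applies. -/
theorem basisElt_mem_of_leading (J : LieIdeal K (u K n)) (a : Omega n) :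
    ∀ (r : K) (y : u K n), r ≠ 0 → y ∈ idealI K n a.pos → r • basisElt K a + y ∈ J →
      basisElt K a ∈ J ∧ idealI K n a.pos ≤ J := by
  induction a using Omega.induction with
  | h a ih =>
    intro r y hr hy hJ
    have key : idealI K n a.pos ≤ J := by
      refine idealI_le_of_forall_basisElt fun b hb => ?_
      obtain ⟨c, d, s, hs, hbd, hda, hcd, hlow⟩ :=
        exists_lie_leading (K := K) ((Omega.lt_iff_pos b a).2 hb)
      have hy' : ⁅basisElt K c, y⁆ ∈ idealI K n d.pos :=
        lie_mem_of_forall_basisElt _ (fun e he => hlow e ((Omega.lt_iff_pos e a).2 he)) hy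
      have h1 : (r * s) • basisElt K d + ⁅basisElt K c, y⁆ ∈ J := by
        have := lie_mem_right K (u K n) J (basisElt K c) _ hJ
        rwa [lie_add, lie_smul, hcd, smul_smul] at this
      obtain ⟨h2, h3⟩ := ih d hda _ _ (mul_ne_zero hr hs) hy' h1
      rcases hbd.lt_or_eq with h | h
      · exact h3 (basisElt_mem_idealI.2 h)
      · rwa [Omega.pos_injective n h]
    refine ⟨?_, key⟩
    have := sub_mem hJ (key hy)
    rw [add_sub_cancel_right] at this
    exact (Submodule.smul_mem_iff J.toSubmodule hr).1 this

theorem eq_idealI_of_basisElt {J : LieIdeal K (u K n)} {kap : Ordinal.{0}}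
    (h : ∀ a : Omega n, basisElt K a ∈ J ↔ a.pos < kap) : J = idealI K n kap := by
  refine le_antisymm (fun x hx => ?_) (idealI_le_of_forall_basisElt fun a => (h a).2)
  by_cases hx0 : x = 0
  · rw [hx0]; exact zero_mem _
  obtain ⟨a, r, y, hr, hy, rfl⟩ := exists_leading hx0
  have ha := (h a).1 (basisElt_mem_of_leading J a r y hr hy hx).1
  exact add_mem (Submodule.smul_mem _ _ (basisElt_mem_idealI.2 ha)) (idealI_mono ha.le hy)

theorem exists_eq_idealI (J : LieIdeal K (u K n)) :
    ∃ lam ≤ ordOmega n, J = idealI K n lam := by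
  have hlower : ∀ a b : Omega n, basisElt K a ∈ J → b.pos < a.pos → basisElt K b ∈ J := by
    intro a b ha hb
    refine (basisElt_mem_of_leading J a 1 0 one_ne_zero (zero_mem _) ?_).2
      (basisElt_mem_idealI.2 hb)
    rwa [one_smul, add_zero]
  by_cases hall : ∀ a : Omega n, basisElt K a ∈ J
  · exact ⟨_, le_rfl, eq_idealI_of_basisElt fun a => ⟨fun _ =>
      a.pos_lt_omegaSum_zero.trans_eq (ordOmega_eq n).symm, fun _ => hall a⟩⟩
  · rw [not_forall] at hall
    -- `λ` is the position of the least basis element outside `J`.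
    obtain ⟨a, ha, hmin⟩ := (InvImage.wf (Omega.pos (n := n))
      (wellFounded_lt (α := Ordinal.{0}))).has_min {a : Omega n | basisElt K a ∉ J} hall
    refine ⟨a.pos, (a.pos_lt_omegaSum_zero.trans_eq (ordOmega_eq n).symm).le,
      eq_idealI_of_basisElt fun b => ⟨fun hb => ?_, fun hb => ?_⟩⟩
    · by_contra hlt
      rcases (not_lt.1 hlt).lt_or_eq with h | h
      · exact ha (hlower b a hb h)
      · exact ha (Omega.pos_injective n h ▸ hb)
    · by_contra hb'
      exact hmin b hb' hb

theorem existsUnique_eq_idealI (J : LieIdeal K (u K n)) :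
    ∃! lam : Ordinal.{0}, lam ≤ ordOmega n ∧ J = idealI K n lam := by
  obtain ⟨lam, hl, h⟩ := exists_eq_idealI J
  exact ⟨lam, ⟨hl, h⟩, fun mu ⟨hm, h'⟩ => idealI_injOn hm hl (h'.symm.trans h)⟩

end Ideals
end TriDer

/-! ### Matching the chains of ideals of two quotients. -/

namespace TriDer

/-- The projection of a Lie algebra onto its quotient by an ideal, as a Lie algebra morphism. -/
def quotMk {K L : Type*} [CommRing K] [LieRing L] [LieAlgebra K L] (I : LieIdeal K L) :
    L →ₗ⁅K⁆ L ⧸ I where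
  toFun := LieSubmodule.Quotient.mk
  map_add' _ _ := rfl
  map_smul' _ _ := rfl
  map_lie' {x y} := LieSubmodule.Quotient.mk_bracket I x y

theorem quotMk_surjective {K L : Type*} [CommRing K] [LieRing L] [LieAlgebra K L]
    (I : LieIdeal K L) : Function.Surjective (quotMk I) :=
  LieSubmodule.Quotient.surjective_mk' I

theorem quotMk_eq_zero {K L : Type*} [CommRing K] [LieRing L] [LieAlgebra K L]
    (I : LieIdeal K L) (x : L) : quotMk I x = 0 ↔ x ∈ I :=
  LieSubmodule.Quotient.mk_eq_zero'

theorem nonempty_quot_equiv {K L Q : Type*} [CommRing K] [LieRing L] [LieAlgebra K L]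
    [LieRing Q] [LieAlgebra K Q] (h : L →ₗ⁅K⁆ Q) (hs : Function.Surjective h) {I : LieIdeal K L}
    (hI : ∀ x, h x = 0 ↔ x ∈ I) : Nonempty ((L ⧸ I) ≃ₗ⁅K⁆ Q) := by
  obtain rfl : I = h.ker := by
    ext x
    rw [LieHom.mem_ker, hI]
  refine ⟨h.quotKerEquivRange.trans (LieEquiv.ofBijective h.range.incl
    ⟨Subtype.val_injective, fun q => ?_⟩)⟩
  obtain ⟨x, rfl⟩ := hs q
  exact ⟨⟨h x, x, rfl⟩, rfl⟩

section Corr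

variable {K : Type*} [Field K] {n : ℕ} {Q : Type*} [LieRing Q] [LieAlgebra K Q]

/-- Two morphisms from `u_n` to the same Lie algebra match the ideals `I_κ` and `I_κ'`. -/
def Corr (f g : u K n →ₗ⁅K⁆ Q) (kap kap' : Ordinal.{0}) : Prop :=
  ∀ x y, f x = g y → (x ∈ idealI K n kap ↔ y ∈ idealI K n kap')

theorem Corr.symm {f g : u K n →ₗ⁅K⁆ Q} {kap kap' : Ordinal.{0}} (h : Corr f g kap kap') :
    Corr g f kap' kap := fun x y hxy => (h y x hxy.symm).symm

theorem Corr.le {f g : u K n →ₗ⁅K⁆ Q} (hf : Function.Surjective f)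
    {kap kap' eta eta' : Ordinal.{0}} (h : Corr f g kap kap') (h' : Corr f g eta eta')
    (hk : kap' ≤ ordOmega n) (hle : kap ≤ eta) : kap' ≤ eta' := by
  refine (idealI_le_iff (K := K) hk).1 fun y hy => ?_
  obtain ⟨x, hx⟩ := hf (g y)
  exact (h' x y hx).1 (idealI_mono hle ((h x y hx).2 hy))

/-- The preimage under `g` of `f(I_κ)` is an ideal because `f` is surjective, so it is some `I_κ'`.
The condition `lam ≤ kap` puts the kernel of `f` inside `I_κ`. -/
theorem Corr.exists [CharZero K] {f g : u K n →ₗ⁅K⁆ Q} (hf : Function.Surjective f)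
    {lam mu : Ordinal.{0}} (hfk : ∀ x, f x = 0 ↔ x ∈ idealI K n lam)
    (hgk : ∀ x, g x = 0 ↔ x ∈ idealI K n mu) (hmu : mu ≤ ordOmega n) {kap : Ordinal.{0}}
    (hk : lam ≤ kap) :
    ∃ kap', mu ≤ kap' ∧ kap' ≤ ordOmega n ∧ Corr f g kap kap' := by
  let J : LieIdeal K (u K n) :=
    { carrier := {y | ∃ x ∈ idealI K n kap, f x = g y}
      zero_mem' := ⟨0, zero_mem _, by simp⟩
      add_mem' := by
        rintro _ _ ⟨x, hx, h⟩ ⟨x', hx', h'⟩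
        exact ⟨x + x', add_mem hx hx', by rw [map_add, map_add, h, h']⟩
      smul_mem' := by
        rintro r _ ⟨x, hx, h⟩
        exact ⟨r • x, Submodule.smul_mem _ r hx, by rw [map_smul, map_smul, h]⟩
      lie_mem := by
        rintro z _ ⟨x, hx, h⟩
        obtain ⟨w, hw⟩ := hf (g z)
        exact ⟨⁅w, x⁆, lie_mem_right K _ _ w x hx, by rw [LieHom.map_lie, LieHom.map_lie, hw, h]⟩ }
  obtain ⟨kap', hk', hJ⟩ := exists_eq_idealI J
  have hmem : ∀ y, y ∈ idealI K n kap' ↔ ∃ x ∈ idealI K n kap, f x = g y := by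
    intro y; rw [← hJ]; exact Iff.rfl
  refine ⟨kap', (idealI_le_iff (K := K) hmu).1 fun y hy => ?_, hk', fun x y hxy => ?_⟩
  · exact (hmem y).2 ⟨0, zero_mem _, by rw [map_zero, (hgk y).2 hy]⟩
  · rw [hmem]
    refine ⟨fun hx => ⟨x, hx, hxy⟩, fun ⟨x', hx', h'⟩ => ?_⟩
    have h0 : f (x - x') = 0 := by rw [map_sub, hxy, h', sub_self]
    have := add_mem (idealI_mono hk ((hfk _).1 h0)) hx'
    rwa [sub_add_cancel] at this

/-- An isomorphism of well-orders preserves distances from the bottom. By strong induction the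
partner of `lam + rho` cannot be `mu + sig` with `sig < rho`, since that one is already taken;
likewise in the other direction. -/
theorem Corr.add [CharZero K] {f g : u K n →ₗ⁅K⁆ Q} (hf : Function.Surjective f)
    (hg : Function.Surjective g)
    {lam mu : Ordinal.{0}} (hfk : ∀ x, f x = 0 ↔ x ∈ idealI K n lam)
    (hgk : ∀ x, g x = 0 ↔ x ∈ idealI K n mu) (hlam : lam ≤ ordOmega n) (hmu : mu ≤ ordOmega n)
    (rho : Ordinal.{0}) (hr : lam + rho ≤ ordOmega n) :
    mu + rho ≤ ordOmega n ∧ Corr f g (lam + rho) (mu + rho) := by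
  induction rho using WellFoundedLT.induction with
  | ind rho ih =>
    obtain ⟨kap', h1, h2, h3⟩ := Corr.exists hf hfk hgk hmu (kap := lam + rho) le_self_add
    obtain ⟨sig, rfl⟩ := exists_add_of_le h1
    have hrs : rho ≤ sig := by
      by_contra hlt
      rw [not_le] at hlt
      have hle : lam + sig ≤ lam + rho := by gcongr
      obtain ⟨-, h⟩ := ih sig hlt (hle.trans hr)
      exact hlt.not_ge ((add_le_add_iff_left lam).1 (Corr.le hg h3.symm h.symm hr le_rfl))
    have hmr : mu + rho ≤ ordOmega n := le_trans (by gcongr) h2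
    obtain ⟨kap, k1, k2, k3⟩ := Corr.exists hg hgk hfk hlam (kap := mu + rho) le_self_add
    obtain ⟨tau, rfl⟩ := exists_add_of_le k1
    have hrt : rho ≤ tau := by
      by_contra hlt
      rw [not_le] at hlt
      have hle : lam + tau ≤ lam + rho := by gcongr
      obtain ⟨-, h⟩ := ih tau hlt (hle.trans hr)
      exact hlt.not_ge ((add_le_add_iff_left mu).1 (Corr.le hf k3.symm h hmr le_rfl))
    -- Monotonicity of the matching applied to `lam + rho ≤ lam + tau` closes the sandwich.
    have hsr : mu + sig ≤ mu + rho := Corr.le hf h3 k3.symm h2 (by gcongr)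
    obtain rfl : rho = sig := le_antisymm hrs ((add_le_add_iff_left mu).1 hsr)
    exact ⟨hmr, h3⟩

/-- Both quotients are `Q / g(I_κ')`. -/
theorem Corr.quot_equiv {f g : u K n →ₗ⁅K⁆ Q} (hf : Function.Surjective f)
    (hg : Function.Surjective g) {kap kap' : Ordinal.{0}} (h : Corr f g kap kap') :
    Nonempty ((u K n ⧸ idealI K n kap) ≃ₗ⁅K⁆ (u K n ⧸ idealI K n kap')) := by
  let M : LieIdeal K Q :=
    { carrier := {q | ∃ y ∈ idealI K n kap', g y = q}
      zero_mem' := ⟨0, zero_mem _, by simp⟩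
      add_mem' := by
        rintro _ _ ⟨x, hx, rfl⟩ ⟨x', hx', rfl⟩
        exact ⟨x + x', add_mem hx hx', by rw [map_add]⟩
      smul_mem' := by
        rintro r _ ⟨x, hx, rfl⟩
        exact ⟨r • x, Submodule.smul_mem _ r hx, by rw [map_smul]⟩
      lie_mem := by
        rintro z _ ⟨x, hx, rfl⟩
        obtain ⟨w, rfl⟩ := hg z
        exact ⟨⁅w, x⁆, lie_mem_right K _ _ w x hx, by rw [LieHom.map_lie]⟩ }
  have hM : ∀ q, q ∈ M ↔ ∃ y ∈ idealI K n kap', g y = q := fun q => Iff.rfl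
  obtain ⟨e⟩ := nonempty_quot_equiv (I := idealI K n kap) ((quotMk M).comp f)
    ((quotMk_surjective M).comp hf) fun x => by
      rw [LieHom.comp_apply, quotMk_eq_zero, hM]
      constructor
      · rintro ⟨y, hy, hxy⟩
        exact (h x y hxy.symm).2 hy
      · intro hx
        obtain ⟨y, hy⟩ := hg (f x)
        exact ⟨y, (h x y hy.symm).1 hx, hy⟩
  obtain ⟨e'⟩ := nonempty_quot_equiv (I := idealI K n kap') ((quotMk M).comp g)
    ((quotMk_surjective M).comp hg) fun y => by
      rw [LieHom.comp_apply, quotMk_eq_zero, hM]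
      constructor
      · rintro ⟨z, hz, hzy⟩
        obtain ⟨x, hx⟩ := hf (g y)
        exact (h x y hx).1 ((h x z (hx.trans hzy.symm)).2 hz)
      · exact fun hy => ⟨y, hy, rfl⟩
  exact ⟨e.trans e'.symm⟩

end Corr
end TriDer

/-! ### The shift endomorphism and the resulting isomorphisms. -/

namespace TriDer
open MvPolynomial

section Shift

variable {K : Type*} [Field K] {n : ℕ}

theorem pderiv_mem_lowerPoly (m i : Fin n) {p : Poly K n} (hp : p ∈ lowerPoly K n i) :
    pderiv m p ∈ lowerPoly K n i := by
  classical
  refine map_lowerPoly (pderiv m) (fun j => ?_) i p hp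
  rw [pderiv_X, Pi.single_apply]
  split_ifs
  · exact one_mem _
  · exact zero_mem _

/-- The coefficients of the derivation obtained from `D` by truncating at `∂_i` and by
differentiating the coefficient at `∂_i` with respect to `X m`. -/
noncomputable def shiftCoeff (m i : Fin n) (D : Der K n) (k : Fin n) : Poly K n :=
  if k < i then D (X k) else if k = i then pderiv m (D (X k)) else 0

theorem shiftCoeff_mem (m i : Fin n) (D : u K n) (k : Fin n) :
    shiftCoeff m i D.1 k ∈ lowerPoly K n k := by
  unfold shiftCoeff
  split_ifs with h h'
  · exact D.2 k
  · exact pderiv_mem_lowerPoly m k (D.2 k)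
  · exact zero_mem _

theorem mkDerivation_shiftCoeff_apply (m i : Fin n) (D : Der K n) {p : Poly K n}
    (hp : p ∈ lowerPoly K n i) : mkDerivation K (shiftCoeff m i D) p = D p := by
  refine derivation_eqOn_supported (fun k (hk : k < i) => ?_) hp
  simp [shiftCoeff, hk]

/-- The commutator kills every `x_k` with `k < i`: the value `D(x_k)` involves only variables before
`x_k`, and `x_m` is the last variable before `x_i`. -/
theorem pderiv_comm {m i : Fin n} (hmi : (m : ℕ) + 1 = i) (D : u K n) {p : Poly K n}
    (hp : p ∈ lowerPoly K n i) : pderiv m (D.1 p) = D.1 (pderiv m p) := by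
  classical
  have h : (⁅(pderiv m : Der K n), D.1⁆ : Der K n) p = (0 : Der K n) p := by
    refine derivation_eqOn_supported (fun k (hk : k < i) => ?_) hp
    have hkm : ¬ m < k := by
      rw [Fin.lt_def] at hk ⊢; omega
    have h1 : pderiv m (D.1 (X k)) = 0 :=
      pderiv_eq_zero_of_notMem_vars fun h => hkm (mem_supported.1 (D.2 k) h)
    have h2 : D.1 (pderiv m (X k)) = 0 := by
      rw [pderiv_X, Pi.single_apply]
      split_ifs
      · exact Derivation.map_one_eq_zero _
      · exact map_zero _
    rw [Function.comp_apply, Derivation.commutator_apply, h1, h2]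
    simp
  rw [Derivation.commutator_apply] at h
  exact sub_eq_zero.1 h

/-- The endomorphism `Σ p_k ∂_k ↦ Σ_{k < i} p_k ∂_k + (∂p_i/∂x_m) ∂_i` of `u_n`, where `x_m` is
the variable just before `x_i`. -/
noncomputable def shiftHom (K : Type*) [Field K] {n : ℕ} {m i : Fin n} (hmi : (m : ℕ) + 1 = i) :
    u K n →ₗ⁅K⁆ u K n where
  toFun D := ⟨mkDerivation K (shiftCoeff m i D.1), fun k => by
    rw [mkDerivation_X]; exact shiftCoeff_mem m i D k⟩
  map_add' D E := by
    refine Subtype.ext (derivation_ext fun k => ?_)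
    change mkDerivation K (shiftCoeff m i (D.1 + E.1)) (X k) =
      mkDerivation K (shiftCoeff m i D.1) (X k) + mkDerivation K (shiftCoeff m i E.1) (X k)
    simp only [mkDerivation_X, shiftCoeff, Derivation.add_apply, map_add]
    split_ifs <;> simp
  map_smul' r D := by
    refine Subtype.ext (derivation_ext fun k => ?_)
    change mkDerivation K (shiftCoeff m i (r • D.1)) (X k) =
      r • mkDerivation K (shiftCoeff m i D.1) (X k)
    simp only [mkDerivation_X, shiftCoeff, Derivation.smul_apply]
    split_ifs <;> simp
  map_lie' := by
    intro D E
    refine Subtype.ext (derivation_ext fun k => ?_)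
    change mkDerivation K (shiftCoeff m i (⁅D.1, E.1⁆ : Der K n)) (X k) =
      (⁅mkDerivation K (shiftCoeff m i D.1), mkDerivation K (shiftCoeff m i E.1)⁆ : Der K n) (X k)
    rw [Derivation.commutator_apply, mkDerivation_X, mkDerivation_X, mkDerivation_X]
    rcases lt_trichotomy k i with h | rfl | h
    · have hsub : lowerPoly K n k ≤ lowerPoly K n i :=
        supported_mono fun j (hj : j < k) => hj.trans h
      simp only [shiftCoeff, if_pos h]
      rw [mkDerivation_shiftCoeff_apply m i _ (hsub (E.2 k)),
        mkDerivation_shiftCoeff_apply m i _ (hsub (D.2 k)), Derivation.commutator_apply]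
    -- The coefficient at `∂_i` is the only delicate one: on polynomials in the variables before
    -- `x_i` the shifted derivations agree with the original ones, and these commute with `∂/∂x_m`.
    · simp only [shiftCoeff, if_true, lt_irrefl, if_false]
      have hD := mkDerivation_shiftCoeff_apply m k D.1 (pderiv_mem_lowerPoly m k (E.2 k))
      have hE := mkDerivation_shiftCoeff_apply m k E.1 (pderiv_mem_lowerPoly m k (D.2 k))
      rw [hD, hE, Derivation.commutator_apply, map_sub, pderiv_comm hmi D (E.2 k),
        pderiv_comm hmi E (D.2 k)]
    · simp [shiftCoeff, h.not_gt, h.ne']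

theorem shiftHom_apply_X {m i : Fin n} (hmi : (m : ℕ) + 1 = i) (D : u K n) (k : Fin n) :
    (shiftHom K hmi D).1 (X k) = shiftCoeff m i D.1 k :=
  mkDerivation_X K _ k

theorem shiftHom_basisElt_of_gt {m i : Fin n} (hmi : (m : ℕ) + 1 = i) {a : Omega n}
    (h : i < a.idx) : shiftHom K hmi (basisElt K a) = 0 := by
  refine Subtype.ext (derivation_ext fun k => ?_)
  rw [shiftHom_apply_X, shiftCoeff, basisElt_X]
  by_cases hk : k = a.idx
  · subst hk
    simp [h.not_gt, h.ne']
  · simp [hk]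

theorem shiftHom_basisElt_of_lt {m i : Fin n} (hmi : (m : ℕ) + 1 = i) {a : Omega n}
    (h : a.idx < i) : shiftHom K hmi (basisElt K a) = basisElt K a := by
  refine Subtype.ext (derivation_ext fun k => ?_)
  rw [shiftHom_apply_X, shiftCoeff, basisElt_X]
  by_cases hk : k = a.idx
  · subst hk
    simp [h]
  · simp [hk]

theorem shiftHom_basisElt_of_eq {m i : Fin n} (hmi : (m : ℕ) + 1 = i) {a b : Omega n}
    (ha : a.idx = i) (hb : b.idx = i) (hab : b.exp = a.exp - Finsupp.single m 1) :
    shiftHom K hmi (basisElt K a) = (a.exp m : K) • basisElt K b := by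
  refine Subtype.ext (derivation_ext fun k => ?_)
  rw [shiftHom_apply_X, shiftCoeff, basisElt_X, smul_basisElt_X, hab, ha, hb]
  by_cases hk : k = i
  · subst hk
    simp [pderiv_monomial]
  · simp [hk]

end Shift

section ShiftKernel

variable {K : Type*} [Field K] [CharZero K] {n : ℕ}

-- The exponent of `x_m` is the top digit in block `i = m + 1`, with weight `ω^m`.
open Ordinal in
theorem Omega.pos_lt_omegaSum_add_iff {m i : Fin n} (hmi : (m : ℕ) + 1 = i) (a : Omega n) :
    a.pos < omegaSum (i + 1) n + ω ^ (m : ℕ) ↔ i < a.idx ∨ (a.idx = i ∧ a.exp m = 0) := by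
  rcases lt_trichotomy a.idx i with h | rfl | h
  · have : ¬ a.pos < omegaSum (i + 1) n + ω ^ (m : ℕ) := by
      rw [not_lt]
      calc omegaSum (i + 1) n + ω ^ (m : ℕ) ≤ omegaSum (i + 1) n + ω ^ (i : ℕ) := by
            gcongr
            · exact one_lt_omega0.le
            · omega
        _ = omegaSum i n := (omegaSum_eq_add i.isLt).symm
        _ ≤ omegaSum (a.idx + 1) n := omegaSum_anti h
        _ ≤ a.pos := a.omegaSum_le_pos
    simp [this, h.not_gt, h.ne]
  · rw [Omega.pos, add_lt_add_iff_left, ← hmi, digitVal, Omega.digits_val]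
    simp only [lt_irrefl, false_or, true_and]
    constructor
    · intro h
      by_contra h0
      refine h.not_ge (le_trans ?_ le_self_add)
      calc ω ^ (m : ℕ) = ω ^ (m : ℕ) * (1 : ℕ) := by simp
        _ ≤ _ := mul_le_mul_right (by exact_mod_cast Nat.one_le_iff_ne_zero.2 h0) _
    · intro h
      rw [h, Nat.cast_zero, mul_zero, zero_add]
      exact digitVal_lt _ _
  · refine iff_of_true ?_ (Or.inl h)
    exact (a.pos_lt_omegaSum.trans_le (omegaSum_anti h)).trans_le le_self_add

/-- `u_n → u_n / I_{OS}`, with `OS = ω^{n-1} + ⋯ + ω^{i+1}`, induced by `shiftHom`. -/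
noncomputable def shiftQuot (K : Type*) [Field K] {n : ℕ} {m i : Fin n} (hmi : (m : ℕ) + 1 = i) :
    u K n →ₗ⁅K⁆ u K n ⧸ idealI K n (omegaSum (i + 1) n) :=
  (quotMk _).comp (shiftHom K hmi)

theorem Omega.pos_lt_omegaSum_iff {s : ℕ} (a : Omega n) : a.pos < omegaSum s n ↔ s ≤ a.idx := by
  constructor
  · intro h
    by_contra hlt
    exact h.not_ge ((omegaSum_anti (by omega)).trans a.omegaSum_le_pos)
  · exact fun h => a.pos_lt_omegaSum.trans_le (omegaSum_anti h)

/-- In characteristic zero monomials can be integrated with respect to `x_m`; the blocks beyond `i`,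
which the shift kills, are already zero in the target. -/
theorem shiftQuot_surjective {m i : Fin n} (hmi : (m : ℕ) + 1 = i) :
    Function.Surjective (shiftQuot K hmi) := by
  intro q
  obtain ⟨x, rfl⟩ := quotMk_surjective _ q
  have hx : x ∈ Submodule.span K (Set.range (basisElt K (n := n))) := by
    rw [span_basisElt]; trivial
  induction hx using Submodule.span_induction with
  | zero => exact ⟨0, by rw [map_zero, map_zero]⟩
  | add y z _ _ hy hz =>
    obtain ⟨y', hy⟩ := hy
    obtain ⟨z', hz⟩ := hz
    exact ⟨y' + z', by rw [map_add, map_add, hy, hz]⟩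
  | smul r y _ hy =>
    obtain ⟨y', hy⟩ := hy
    exact ⟨r • y', by rw [map_smul, map_smul, hy]⟩
  | mem y hy =>
    obtain ⟨a, rfl⟩ := hy
    rcases lt_trichotomy a.idx i with h | h | h
    · exact ⟨basisElt K a, by rw [shiftQuot, LieHom.comp_apply, shiftHom_basisElt_of_lt hmi h]⟩
    · have hm : m < i := by rw [Fin.lt_def]; omega
      let b : Omega n := ⟨i, a.exp + Finsupp.single m 1, fun k hk => by
        simp [a.exp_eq_zero k (h.trans_le hk), (hm.trans_le hk).ne]⟩
      have hb : ((a.exp m + 1 : ℕ) : K) ≠ 0 := Nat.cast_ne_zero.2 (Nat.succ_ne_zero _)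
      refine ⟨((a.exp m + 1 : ℕ) : K)⁻¹ • basisElt K b, ?_⟩
      rw [shiftQuot, LieHom.comp_apply, map_smul, shiftHom_basisElt_of_eq hmi (a := b) (b := a)
        rfl h (by simp [b]), smul_smul]
      have : b.exp m = a.exp m + 1 := by simp [b]
      rw [this, inv_mul_cancel₀ hb, one_smul]
    · refine ⟨0, ?_⟩
      rw [map_zero, eq_comm, quotMk_eq_zero, basisElt_mem_idealI, Omega.pos_lt_omegaSum_iff]
      exact h

open Ordinal in
theorem shiftQuot_eq_zero {m i : Fin n} (hmi : (m : ℕ) + 1 = i) (x : u K n) :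
    shiftQuot K hmi x = 0 ↔ x ∈ idealI K n (omegaSum (i + 1) n + ω ^ (m : ℕ)) := by
  rw [← LieHom.mem_ker]
  suffices h : (shiftQuot K hmi).ker = idealI K n (omegaSum (i + 1) n + ω ^ (m : ℕ)) by rw [h]
  refine eq_idealI_of_basisElt fun a => ?_
  rw [Omega.pos_lt_omegaSum_add_iff hmi, LieHom.mem_ker, shiftQuot, LieHom.comp_apply,
    quotMk_eq_zero]
  rcases lt_trichotomy a.idx i with h | h | h
  · rw [shiftHom_basisElt_of_lt hmi h, basisElt_mem_idealI, Omega.pos_lt_omegaSum_iff]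
    refine iff_of_false (fun h' => ?_) ?_
    · rw [Fin.lt_def] at h; omega
    · simp [h.ne, h.not_gt]
  · rw [shiftHom_basisElt_of_eq hmi (a := a) (b := ⟨i, a.exp - Finsupp.single m 1, fun k hk => by
      simp [a.exp_eq_zero k (h.trans_le hk)]⟩) h rfl rfl]
    by_cases h0 : a.exp m = 0
    · rw [h0, Nat.cast_zero, zero_smul]
      exact iff_of_true (zero_mem _) (Or.inr ⟨h, rfl⟩)
    · refine iff_of_false (fun h' => ?_) (by simp [h, h0])
      have := (Submodule.smul_mem_iff (idealI K n (omegaSum (i + 1) n)).toSubmodule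
        (Nat.cast_ne_zero.2 h0)).1 h'
      have := (Omega.pos_lt_omegaSum_iff _).1 (basisElt_mem_idealI.1 this)
      simp at this
  · rw [shiftHom_basisElt_of_gt hmi h]
    exact iff_of_true (zero_mem _) (Or.inl h)

-- `shiftQuot` and the projection are two surjections onto `u_n / I_S`, `S = omegaSum (i + 1) n`,
-- with kernels `I_{S+ω^m}` and `I_S`; the chains above these kernels match.
open Ordinal in
theorem quot_equiv_add {m i : Fin n} (hmi : (m : ℕ) + 1 = i) {rho : Ordinal.{0}}
    (hr : omegaSum (i + 1) n + ω ^ (m : ℕ) + rho ≤ ordOmega n) :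
    Nonempty ((u K n ⧸ idealI K n (omegaSum (i + 1) n + ω ^ (m : ℕ) + rho)) ≃ₗ⁅K⁆
      (u K n ⧸ idealI K n (omegaSum (i + 1) n + rho))) := by
  have h1 : omegaSum (i + 1) n + ω ^ (m : ℕ) ≤ ordOmega n := le_self_add.trans hr
  have h := Corr.add (shiftQuot_surjective (K := K) hmi) (quotMk_surjective _)
    (shiftQuot_eq_zero hmi) (quotMk_eq_zero _) h1 (le_self_add.trans h1) rho hr
  exact h.2.quot_equiv (shiftQuot_surjective hmi) (quotMk_surjective _)

end ShiftKernel
end TriDer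

/-! ### Annihilators as an invariant. -/

namespace TriDer

open Ordinal

section Annihilator

variable {K : Type*} [Field K] {n : ℕ}

/-- The ideal of the elements that bracket `I_κ` into `I_λ`. -/
noncomputable def annihilator (K : Type*) [Field K] (n : ℕ) (lam kap : Ordinal.{0}) :
    LieIdeal K (u K n) where
  carrier := {x | ∀ y ∈ idealI K n kap, ⁅x, y⁆ ∈ idealI K n lam}
  zero_mem' y _ := by rw [zero_lie]; exact zero_mem _
  add_mem' hx hx' y hy := by rw [add_lie]; exact add_mem (hx y hy) (hx' y hy)
  smul_mem' r x hx y hy := by rw [smul_lie]; exact Submodule.smul_mem _ r (hx y hy)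
  lie_mem {z x} hx y hy := by
    rw [lie_lie]
    exact sub_mem (lie_mem_right K _ _ z _ (hx y hy)) (hx _ (lie_mem_right K _ _ z y hy))

theorem mem_annihilator {lam kap : Ordinal.{0}} {x : u K n} :
    x ∈ annihilator K n lam kap ↔ ∀ y ∈ idealI K n kap, ⁅x, y⁆ ∈ idealI K n lam := Iff.rfl

theorem Corr.annihilator_imp {Q : Type*} [LieRing Q] [LieAlgebra K Q] {f g : u K n →ₗ⁅K⁆ Q}
    (hf : Function.Surjective f) {lam mu kap kap' : Ordinal.{0}} (h : Corr f g lam mu)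
    (h' : Corr f g kap kap') {x x' : u K n} (hx : f x = g x') (hm : x ∈ annihilator K n lam kap) :
    x' ∈ annihilator K n mu kap' := by
  rw [mem_annihilator] at hm ⊢
  intro y' hy'
  obtain ⟨y, hy⟩ := hf (g y')
  exact (h ⁅x, y⁆ ⁅x', y'⁆ (by rw [LieHom.map_lie, LieHom.map_lie, hx, hy])).1
    (hm y ((h' y y' hy).2 hy'))

/-- The element `(e_m, i)` of `Ω_n`. -/
noncomputable def Omega.unit {m i : Fin n} (hmi : (m : ℕ) + 1 = i) : Omega n where
  idx := i
  exp := Finsupp.single m 1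
  exp_eq_zero k hk := by
    have : m ≠ k := fun h => by rw [← h, Fin.le_def] at hk; omega
    simp [this]

theorem Omega.unit_pos {m i : Fin n} (hmi : (m : ℕ) + 1 = i) :
    (unit hmi).pos = omegaSum (i + 1) n + ω ^ (m : ℕ) := by
  have h0 : ∀ (d : ℕ → ℕ) (k : ℕ), (∀ j < k, d j = 0) → digitVal d k = 0 := by
    intro d k
    induction k with
    | zero => exact fun _ => rfl
    | succ k ih => exact fun h => by rw [digitVal, h k k.lt_succ_self, ih fun j hj => h j (by omega)]
                                     simp
  have hi : (unit hmi).idx = i := rfl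
  rw [pos, hi, ← hmi, digitVal, digits_val, h0 _ (m : ℕ)]
  · simp [unit]
  · intro j hj
    have hj' : j < n := hj.trans m.isLt
    have : m ≠ ⟨j, hj'⟩ := fun h => by rw [h] at hj; exact lt_irrefl _ hj
    simp [digits, hj', unit, this]

/-- `[x^γ ∂_m, x_m ∂_i] = x^γ ∂_i`: bracketing with `x_m ∂_i` carries block `m` onto the first `ω^m`
places of block `i`, keeping relative positions. -/
theorem bracketIdx_unit_pos {m i : Fin n} (hmi : (m : ℕ) + 1 = i) {c : Omega n} (hc : c.idx = m)
    (h : c.idx ≤ (Omega.unit hmi).idx) {rho : Ordinal.{0}} (hr : c.pos = omegaSum i n + rho) :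
    (bracketIdx c (Omega.unit hmi) h).pos = omegaSum (i + 1) n + rho := by
  have he : (bracketIdx c (Omega.unit hmi) h).exp = c.exp := by
    simp [bracketIdx, Omega.unit, hc]
  have hd : (bracketIdx c (Omega.unit hmi) h).digits = c.digits := by
    funext j
    rw [Omega.digits, he, Omega.digits]
  have hi : (bracketIdx c (Omega.unit hmi) h).idx = i := rfl
  rw [Omega.pos, hc, hmi, add_right_inj] at hr
  rw [Omega.pos, hd, hi, ← hr]
  nth_rewrite 2 [← hmi]
  rw [digitVal, Omega.digits_val, c.exp_eq_zero m hc.le]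
  simp

theorem omegaSum_add_lt {i : ℕ} (hi : i < n) {nu : Ordinal.{0}} (h : nu < ω ^ i) :
    omegaSum (i + 1) n + nu < omegaSum i n := by
  rw [omegaSum_eq_add hi]
  gcongr

/-- Modulo the blocks beyond `i`, the ideal being annihilated is spanned by the `x^β ∂_i` free of
`x_m` and by `x_m ∂_i`. Among elements of block `m` or of earlier blocks, only `x^γ ∂_m` acts
nontrivially, sending `x_m ∂_i` to `x^γ ∂_i`; this lies in `I_{S+ν}`, `S = omegaSum (i + 1) n`,
exactly when `x^γ` has relative position below `ν`. -/
theorem annihilator_eq [CharZero K] {m i : Fin n} (hmi : (m : ℕ) + 1 = i) {nu : Ordinal.{0}}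
    (hnu : nu < ω ^ (m : ℕ)) :
    annihilator K n (omegaSum (i + 1) n + nu) (omegaSum (i + 1) n + ω ^ (m : ℕ) + 1) =
      idealI K n (omegaSum i n + nu) := by
  have hmi' : m < i := by rw [Fin.lt_def]; omega
  refine eq_idealI_of_basisElt fun c => ⟨fun hc => ?_, fun hc => ?_⟩
  · by_contra hlt
    -- This is the first basis element that must not annihilate: its bracket with `x_m ∂_i` sits
    -- exactly at the excluded position `omegaSum (i + 1) n + nu`.
    obtain ⟨a, ha, hpos⟩ := Omega.exists_pos_eq_of_lt m hnu
    rw [hmi] at hpos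
    have haZ : basisElt K a ∈
        annihilator K n (omegaSum (i + 1) n + nu) (omegaSum (i + 1) n + ω ^ (m : ℕ) + 1) := by
      obtain ⟨th, -, hth⟩ := exists_eq_idealI (annihilator K n (omegaSum (i + 1) n + nu)
        (omegaSum (i + 1) n + ω ^ (m : ℕ) + 1))
      rw [hth, basisElt_mem_idealI] at hc ⊢
      exact (hpos.trans_le (not_lt.1 hlt)).trans_lt hc
    have hle : a.idx ≤ (Omega.unit hmi).idx := ha.trans_le hmi'.le
    have hbr := mem_annihilator.1 haZ (basisElt K (Omega.unit hmi))
      (basisElt_mem_idealI.2 (by rw [Omega.unit_pos]; exact Order.lt_add_one_iff.2 le_rfl))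
    rw [lie_basisElt_eq K _ _ hle] at hbr
    have h1 : (Omega.unit hmi).exp a.idx = 1 := by simp [Omega.unit, ha]
    rw [h1, Nat.cast_one, one_smul, basisElt_mem_idealI, bracketIdx_unit_pos hmi ha hle hpos] at hbr
    exact lt_irrefl _ hbr
  · refine mem_annihilator.2 fun y hy => lie_mem_of_forall_basisElt _ (fun d hd => ?_) hy
    have hpow : (ω : Ordinal.{0}) ^ (m : ℕ) < ω ^ (i : ℕ) := by
      rw [← hmi]
      exact pow_lt_pow_right₀ one_lt_omega0 (Nat.lt_succ_self _)
    have hcm : (m : ℕ) ≤ c.idx := by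
      rw [← Omega.pos_lt_omegaSum_iff]
      refine hc.trans ?_
      rw [← hmi]
      exact omegaSum_add_lt m.isLt hnu
    rw [Order.lt_add_one_iff] at hd
    have hdi : (i : ℕ) ≤ d.idx := by
      rw [← Omega.pos_lt_omegaSum_iff]
      exact hd.trans_lt (omegaSum_add_lt i.isLt hpow)
    have hOS : ∀ e : Omega n, (i : ℕ) < e.idx →
        basisElt K e ∈ idealI K n (omegaSum (i + 1) n + nu) := fun e he =>
      basisElt_mem_idealI.2 (((Omega.pos_lt_omegaSum_iff e).2 he).trans_le le_self_add)
    rcases hdi.lt_or_eq with hdi | hdi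
    · exact lie_mem_right K _ _ _ _ (hOS d hdi)
    rcases lt_or_ge (i : ℕ) c.idx with hci | hci
    · exact lie_mem_left K _ _ _ _ (hOS c hci)
    by_cases hcd : c.idx = d.idx
    · rw [lie_basisElt_of_eq K c d hcd]
      exact zero_mem _
    have hcm' : c.idx = m := by
      rw [Fin.ext_iff] at hcd ⊢
      omega
    have hdi' : d.idx = i := Fin.ext hdi.symm
    have hcd' : c.idx ≤ d.idx := by rw [hcm', hdi']; exact hmi'.le
    rw [← Omega.unit_pos hmi] at hd
    rcases hd.lt_or_eq with hd | hd
    -- An element of block `i` before `x_m ∂_i` does not involve `x_m`, so `∂_m` kills its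
    -- coefficient.
    · have h0 : d.exp c.idx = 0 := by
        rcases (Omega.lt_iff_pos _ _).2 hd with h | ⟨-, k, -, hk⟩
        · exact absurd (Fin.lt_def.1 h) (by rw [hdi']; exact lt_irrefl _)
        · have hk' : (Finsupp.single m 1 : Fin n →₀ ℕ) k ≠ 0 := Nat.ne_zero_of_lt hk
          obtain rfl : m = k := by
            by_contra hne
            exact hk' (Finsupp.single_eq_of_ne (Ne.symm hne))
          have : (Omega.unit hmi).exp m = 1 := by simp [Omega.unit]
          rw [hcm']
          omega
      rw [lie_basisElt_eq K c d hcd', h0, Nat.cast_zero, zero_smul]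
      exact zero_mem _
    · obtain rfl := Omega.pos_injective n hd
      rw [lie_basisElt_eq K _ _ hcd']
      refine Submodule.smul_mem _ _ (basisElt_mem_idealI.2 ?_)
      have hge : omegaSum i n ≤ c.pos := by
        have := c.omegaSum_le_pos
        rwa [hcm', hmi] at this
      obtain ⟨rho, hrho⟩ := exists_add_of_le hge
      rw [bracketIdx_unit_pos hmi hcm' hcd' hrho]
      rw [hrho] at hc
      gcongr
      exact (add_lt_add_iff_left _).1 hc

end Annihilator

/-! ### Classification of the quotients. -/

section Invariants

variable {K : Type*} [Field K] [CharZero K] {n : ℕ}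

theorem exists_corr {lam mu : Ordinal.{0}}
    (e : (u K n ⧸ idealI K n lam) ≃ₗ⁅K⁆ (u K n ⧸ idealI K n mu))
    (hl : lam ≤ ordOmega n) (hm : mu ≤ ordOmega n) :
    ∃ f g : u K n →ₗ⁅K⁆ (u K n ⧸ idealI K n mu), Function.Surjective f ∧ Function.Surjective g ∧
      ∀ rho, lam + rho ≤ ordOmega n →
        mu + rho ≤ ordOmega n ∧ Corr f g (lam + rho) (mu + rho) := by
  have hs : Function.Surjective (e.toLieHom.comp (quotMk (idealI K n lam))) :=
    e.surjective.comp (quotMk_surjective _)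
  refine ⟨e.toLieHom.comp (quotMk _), quotMk _, hs, quotMk_surjective _,
    Corr.add hs (quotMk_surjective _) (fun x => ?_) (quotMk_eq_zero _) hl hm⟩
  rw [← quotMk_eq_zero]
  exact map_eq_zero_iff e e.injective

theorem compl_eq_of_equiv {lam mu rho sig : Ordinal.{0}}
    (h : Nonempty ((u K n ⧸ idealI K n lam) ≃ₗ⁅K⁆ (u K n ⧸ idealI K n mu)))
    (hl : lam + rho = ordOmega n) (hm : mu + sig = ordOmega n) : rho = sig := by
  obtain ⟨e⟩ := h
  have hl' : lam ≤ ordOmega n := hl ▸ le_self_add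
  have hm' : mu ≤ ordOmega n := hm ▸ le_self_add
  obtain ⟨_, _, -, -, h1⟩ := exists_corr e hl' hm'
  obtain ⟨_, _, -, -, h2⟩ := exists_corr e.symm hm' hl'
  refine le_antisymm ((add_le_add_iff_left mu).1 ?_) ((add_le_add_iff_left lam).1 ?_)
  · exact (h1 rho hl.le).1.trans hm.ge
  · exact (h2 sig hm.le).1.trans hl.ge

theorem add_omega0_pow {nu : Ordinal.{0}} {k : ℕ} (h : nu < ω ^ k) : nu + ω ^ k = ω ^ k := by
  rw [← opow_natCast] at h ⊢
  exact add_omega0_opow h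

/-- The isomorphism matches `I_{S+ω^m+1}`, `S = omegaSum (i + 1) n`, with itself, hence also the
annihilators, at `omegaSum i n + nu` and `omegaSum i n + nu'`. Counting from the bottom, it also
matches `omegaSum i n + nu` with itself. -/
theorem eq_of_equiv {m i : Fin n} (hmi : (m : ℕ) + 1 = i) {nu nu' : Ordinal.{0}}
    (hnu : nu < ω ^ (m : ℕ)) (hnu' : nu' < ω ^ (m : ℕ))
    (h : Nonempty ((u K n ⧸ idealI K n (omegaSum (i + 1) n + nu)) ≃ₗ⁅K⁆
      (u K n ⧸ idealI K n (omegaSum (i + 1) n + nu')))) : nu = nu' := by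
  obtain ⟨e⟩ := h
  have hpow : (ω : Ordinal.{0}) ^ (m : ℕ) < ω ^ (i : ℕ) := by
    rw [← hmi]
    exact pow_lt_pow_right₀ one_lt_omega0 (Nat.lt_succ_self _)
  have hT : ∀ k : ℕ, omegaSum k n ≤ ordOmega n := fun k =>
    (omegaSum_anti (Nat.zero_le k)).trans_eq (ordOmega_eq n).symm
  have hb : ∀ r : Ordinal.{0}, r < ω ^ (m : ℕ) → omegaSum i n + r ≤ ordOmega n := by
    intro r hr
    rw [← hmi]
    exact (omegaSum_add_lt m.isLt hr).le.trans (hT _)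
  have hb' : ∀ r : Ordinal.{0}, r < ω ^ (i : ℕ) → omegaSum (i + 1) n + r ≤ ordOmega n :=
    fun r hr => (omegaSum_add_lt i.isLt hr).le.trans (hT _)
  -- Since `r + ω^m = ω^m`, the end position does not depend on the remainder; in `e2` the summand
  -- `ω^i` absorbs `r` in the same way.
  have e1 : ∀ r : Ordinal.{0}, r < ω ^ (m : ℕ) →
      omegaSum (i + 1) n + r + (ω ^ (m : ℕ) + 1) = omegaSum (i + 1) n + ω ^ (m : ℕ) + 1 := by
    intro r hr
    rw [add_assoc, ← add_assoc r, add_omega0_pow hr, add_assoc]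
  have e2 : ∀ r : Ordinal.{0}, r < ω ^ (m : ℕ) →
      omegaSum (i + 1) n + r + (ω ^ (i : ℕ) + nu) = omegaSum i n + nu := by
    intro r hr
    rw [add_assoc, ← add_assoc r, add_omega0_pow (hr.trans hpow), omegaSum_eq_add i.isLt, add_assoc]
  have hb1 : omegaSum (i + 1) n + ω ^ (m : ℕ) + 1 ≤ ordOmega n :=
    (Order.add_one_le_iff.2 (omegaSum_add_lt i.isLt hpow)).trans (hT _)
  obtain ⟨f, g, hf, hg, hcorr⟩ := exists_corr e (hb' _ (hnu.trans hpow)) (hb' _ (hnu'.trans hpow))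
  have c0 := (hcorr 0 (by rw [add_zero]; exact hb' _ (hnu.trans hpow))).2
  rw [add_zero, add_zero] at c0
  have c1 := (hcorr (ω ^ (m : ℕ) + 1) (by rw [e1 _ hnu]; exact hb1)).2
  rw [e1 _ hnu, e1 _ hnu'] at c1
  have c2 := (hcorr (ω ^ (i : ℕ) + nu) (by rw [e2 _ hnu]; exact hb _ hnu)).2
  rw [e2 _ hnu, e2 _ hnu'] at c2
  have c3 : Corr f g (omegaSum i n + nu) (omegaSum i n + nu') := by
    intro x y hxy
    rw [← annihilator_eq hmi hnu, ← annihilator_eq hmi hnu']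
    exact ⟨c0.annihilator_imp hf c1 hxy, c0.symm.annihilator_imp hg c1.symm hxy.symm⟩
  exact le_antisymm ((add_le_add_iff_left _).1 (Corr.le hf c2 c3 (hb _ hnu) le_rfl))
    ((add_le_add_iff_left _).1 (Corr.le hf c3 c2 (hb _ hnu') le_rfl))

theorem mul_natCast_add_lt {m : ℕ} {nu : Ordinal.{0}} (h : nu < ω ^ m) (k : ℕ) :
    ω ^ m * (k : Ordinal.{0}) + nu < ω ^ (m + 1) := by
  rw [pow_succ]
  calc ω ^ m * (k : Ordinal.{0}) + nu < ω ^ m * (k : Ordinal.{0}) + ω ^ m := by gcongr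
    _ = ω ^ m * ((k + 1 : ℕ) : Ordinal.{0}) := by rw [Nat.cast_add, Nat.cast_one, mul_add, mul_one]
    _ ≤ ω ^ m * ω := mul_le_mul_right (natCast_lt_omega0 _).le _

theorem quot_equiv_mul_add {m : ℕ} (hm : m + 2 ≤ n) {nu : Ordinal.{0}} (hnu : nu < ω ^ m) (k : ℕ) :
    Nonempty ((u K n ⧸ idealI K n (omegaSum (m + 2) n + ω ^ m * (k : Ordinal.{0}) + nu)) ≃ₗ⁅K⁆
      (u K n ⧸ idealI K n (omegaSum (m + 2) n + nu))) := by
  induction k with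
  | zero =>
    rw [Nat.cast_zero, mul_zero, add_zero]
    exact ⟨LieEquiv.refl⟩
  | succ k ih =>
    obtain ⟨e⟩ := ih
    -- The extra copy of `ω^m` is split off on the left, where `quot_equiv_add` removes it.
    have hk : omegaSum (m + 2) n + ω ^ m * ((k + 1 : ℕ) : Ordinal.{0}) + nu =
        omegaSum (m + 2) n + ω ^ m + (ω ^ m * (k : Ordinal.{0}) + nu) := by
      rw [add_comm k 1, Nat.cast_add, Nat.cast_one, mul_add, mul_one]
      simp only [add_assoc]
    obtain ⟨e'⟩ := quot_equiv_add (K := K) (n := n) (m := ⟨m, by omega⟩) (i := ⟨m + 1, by omega⟩) rfl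
      (rho := ω ^ m * (k : Ordinal.{0}) + nu) (by
        change omegaSum (m + 2) n + ω ^ m + (ω ^ m * (k : Ordinal.{0}) + nu) ≤ _
        rw [← hk, add_assoc]
        exact ((omegaSum_add_lt (by omega) (mul_natCast_add_lt hnu _)).le.trans
          (omegaSum_anti (Nat.zero_le _))).trans_eq (ordOmega_eq n).symm)
    rw [hk]
    rw [add_assoc] at e
    exact ⟨e'.trans e⟩

theorem omegaSum_zero_strictMono : StrictMono (omegaSum 0) := by
  have h : ∀ k, omegaSum 0 k < ω ^ k := by
    intro k
    induction k with
    | zero => simp [omegaSum]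
    | succ k ih =>
      rw [omegaSum, if_pos (Nat.zero_le k)]
      simpa using mul_natCast_add_lt ih 1
  refine strictMono_nat_of_lt_succ fun k => (h k).trans_le ?_
  rw [omegaSum, if_pos (Nat.zero_le k)]
  exact le_self_add

theorem add_omegaSum_zero {m : ℕ} (hm : m < n) {r : Ordinal.{0}} (hr : r < ω ^ m) :
    omegaSum (m + 1) n + r + omegaSum 0 (m + 1) = ordOmega n := by
  have h : r + omegaSum 0 (m + 1) = omegaSum 0 (m + 1) := by
    rw [omegaSum, if_pos (Nat.zero_le m), ← add_assoc, add_omega0_pow hr]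
  rw [add_assoc, h, omegaSum_add (Nat.zero_le _) hm, ordOmega_eq]

/-- For `s > 0`, `λ` lies in block `s - 1`; `s = 0` means `λ = ord(Ω_n)`. What remains after `λ` is
`omegaSum 0 s`, because the offset inside a block is absorbed by the power of `ω` that measures the
block. For `s = m + 2`, the top digit `k` is separated as the part that isomorphisms forget. -/
theorem exists_normalForm (hn : 1 ≤ n) {lam : Ordinal.{0}} (h : lam ≤ ordOmega n) :
    ∃ s, lam + omegaSum 0 s = ordOmega n ∧
      ((s = 0 ∧ lam = omegaSum 1 n + 1) ∨ (s = 1 ∧ lam = omegaSum 1 n + 0) ∨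
        ∃ (m k : ℕ) (nu : Ordinal.{0}), s = m + 2 ∧ m + 2 ≤ n ∧ nu < ω ^ m ∧
          lam = omegaSum (m + 2) n + ω ^ m * (k : Ordinal.{0}) + nu) := by
  have h1 : omegaSum 0 n = omegaSum 1 n + 1 := by
    rw [omegaSum_eq_add (s := 0) (by omega), pow_zero]
  rcases h.lt_or_eq with h | rfl
  · rw [ordOmega_eq, h1, Order.lt_add_one_iff] at h
    rcases h.lt_or_eq with h | rfl
    · obtain ⟨a, rfl⟩ := Omega.exists_pos_eq hn h
      have ha : 1 ≤ (a.idx : ℕ) := (Omega.pos_lt_omegaSum_iff a).1 h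
      obtain ⟨m, hm⟩ : ∃ m, (a.idx : ℕ) = m + 1 := ⟨a.idx - 1, by omega⟩
      have hi := a.idx.isLt
      have hpos : a.pos = omegaSum (m + 2) n + ω ^ m * (a.digits m : Ordinal.{0}) +
          digitVal a.digits m := by
        rw [Omega.pos, hm, digitVal, ← add_assoc]
      refine ⟨m + 2, ?_, Or.inr (Or.inr ⟨m, a.digits m, digitVal a.digits m, rfl, by omega,
        digitVal_lt _ _, hpos⟩)⟩
      rw [hpos, add_assoc (omegaSum _ _)]
      exact add_omegaSum_zero (m := m + 1) (by omega) (mul_natCast_add_lt (digitVal_lt _ _) _)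
    · refine ⟨1, ?_, Or.inr (Or.inl ⟨rfl, (add_zero _).symm⟩)⟩
      rw [ordOmega_eq, omegaSum_add (Nat.zero_le 1) hn]
  · exact ⟨0, add_zero _, Or.inl ⟨rfl, by rw [ordOmega_eq, h1]⟩⟩

theorem quot_equiv_iff (hn : 2 ≤ n) {lam mu : Ordinal.{0}} (hl : lam ≤ ordOmega n)
    (hm : mu ≤ ordOmega n) :
    Nonempty ((u K n ⧸ idealI K n lam) ≃ₗ⁅K⁆ (u K n ⧸ idealI K n mu)) ↔
      ((∃ (i j : ℕ) (nu : Ordinal.{0}), nu < ω ^ (n - 2) ∧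
          lam = ω ^ (n - 2) * i + nu ∧ mu = ω ^ (n - 2) * j + nu) ∨
        (∃ (s i j : ℕ) (nu : Ordinal.{0}), 2 ≤ s ∧ s ≤ n - 1 ∧ nu < ω ^ (s - 2) ∧
          lam = omegaSum s n + ω ^ (s - 2) * i + nu ∧
          mu = omegaSum s n + ω ^ (s - 2) * j + nu) ∨
        (∃ eps : Ordinal.{0}, (eps = 0 ∨ eps = 1) ∧
          lam = omegaSum 1 n + eps ∧ mu = omegaSum 1 n + eps)) := by
  have hback : ∀ (m i j : ℕ) (nu : Ordinal.{0}), m + 2 ≤ n → nu < ω ^ m →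
      Nonempty ((u K n ⧸ idealI K n (omegaSum (m + 2) n + ω ^ m * (i : Ordinal.{0}) + nu)) ≃ₗ⁅K⁆
        (u K n ⧸ idealI K n (omegaSum (m + 2) n + ω ^ m * (j : Ordinal.{0}) + nu))) := by
    intro m i j nu hm hnu
    obtain ⟨e⟩ := quot_equiv_mul_add (K := K) hm hnu i
    obtain ⟨e'⟩ := quot_equiv_mul_add (K := K) hm hnu j
    exact ⟨e.trans e'.symm⟩
  constructor
  · intro h
    obtain ⟨s, hs, hlam⟩ := exists_normalForm (by omega) hl
    obtain ⟨t, ht, hmu⟩ := exists_normalForm (by omega) hm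
    obtain rfl : s = t := omegaSum_zero_strictMono.injective (compl_eq_of_equiv h hs ht)
    rcases hlam with ⟨h1, h2⟩ | ⟨h1, h2⟩ | ⟨m, k, nu, h1, hmn, hnu, h2⟩
    · rcases hmu with ⟨h3, h4⟩ | ⟨h3, h4⟩ | ⟨m', k', nu', h3, hmn', hnu', h4⟩
      · exact Or.inr (Or.inr ⟨1, Or.inr rfl, h2, h4⟩)
      all_goals omega
    · rcases hmu with ⟨h3, h4⟩ | ⟨h3, h4⟩ | ⟨m', k', nu', h3, hmn', hnu', h4⟩
      · omega
      · exact Or.inr (Or.inr ⟨0, Or.inl rfl, h2, h4⟩)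
      · omega
    · rcases hmu with ⟨h3, h4⟩ | ⟨h3, h4⟩ | ⟨m', k', nu', h3, hmn', hnu', h4⟩
      · omega
      · omega
      obtain rfl : m = m' := by omega
      subst h2 h4
      obtain ⟨e⟩ := h
      obtain ⟨e1⟩ := quot_equiv_mul_add (K := K) hmn hnu k
      obtain ⟨e2⟩ := quot_equiv_mul_add (K := K) hmn hnu' k'
      obtain rfl : nu = nu' := eq_of_equiv (K := K) (n := n) (m := ⟨m, by omega⟩)
        (i := ⟨m + 1, by omega⟩) rfl hnu hnu' ⟨(e1.symm.trans e).trans e2⟩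
      -- For `m + 2 = n` the sum `omegaSum n n` is empty, which gives alternative (a).
      rcases hmn.lt_or_eq with hlt | rfl
      · exact Or.inr (Or.inl ⟨m + 2, k, k', nu, by omega, by omega, hnu, rfl, rfl⟩)
      · refine Or.inl ⟨k, k', nu, hnu, ?_, ?_⟩ <;>
          rw [omegaSum_of_le le_rfl, zero_add] <;> rfl
  · rintro (⟨i, j, nu, hnu, rfl, rfl⟩ | ⟨s, i, j, nu, h2, hs, hnu, rfl, rfl⟩ |
      ⟨eps, -, rfl, rfl⟩)
    · have := hback (n - 2) i j nu (by omega) hnu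
      rwa [omegaSum_of_le (by omega), zero_add, zero_add] at this
    · obtain ⟨m, rfl⟩ : ∃ m, s = m + 2 := ⟨s - 2, by omega⟩
      exact hback m i j nu (by omega) hnu
    · exact ⟨LieEquiv.refl⟩

theorem equiv_quot_iff (hn : 2 ≤ n) {lam : Ordinal.{0}} (hl : lam ≤ ordOmega n) :
    Nonempty (u K n ≃ₗ⁅K⁆ (u K n ⧸ idealI K n lam)) ↔ ∃ i : ℕ, lam = ω ^ (n - 2) * i := by
  have hid : Function.Surjective (LieHom.id : u K n →ₗ⁅K⁆ u K n) := fun x => ⟨x, rfl⟩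
  obtain ⟨e0⟩ := nonempty_quot_equiv (I := idealI K n 0) LieHom.id hid fun x => by
    rw [idealI_zero, LieSubmodule.mem_bot, LieHom.id_apply]
  -- With `u_n` viewed as `u_n / I_0`, this excludes alternatives (b) and (c), whose ordinals are
  -- never `0`.
  have h0 : ∀ s ≤ n - 1, omegaSum s n ≠ 0 := by
    intro s hs
    refine (lt_of_lt_of_le ?_ (omegaSum_anti hs)).ne'
    rw [omegaSum_eq_add (by omega)]
    exact (pow_pos omega0_pos _).trans_le le_add_self
  have key := quot_equiv_iff (K := K) hn (lam := 0) zero_le hl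
  constructor
  · rintro ⟨e⟩
    rcases key.1 ⟨e0.trans e⟩ with ⟨i, j, nu, -, h, rfl⟩ | ⟨s, i, j, nu, -, hs, -, h, -⟩ |
      ⟨eps, -, h, -⟩
    · obtain rfl : nu = 0 := nonpos_iff_eq_zero.1 (le_add_self.trans h.ge)
      exact ⟨j, add_zero _⟩
    · exact absurd (nonpos_iff_eq_zero.1 ((le_self_add.trans le_self_add).trans h.ge)) (h0 s hs)
    · exact absurd (nonpos_iff_eq_zero.1 (le_self_add.trans h.ge)) (h0 1 (by omega))
  · rintro ⟨j, rfl⟩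
    obtain ⟨e⟩ := key.2 (Or.inl ⟨0, j, 0, pow_pos omega0_pos _, by simp, by simp⟩)
    exact ⟨e0.symm.trans e⟩

end Invariants
end TriDer

theorem mainTheorem2 (K : Type*) [Field K] [CharZero K] (n : ℕ) (hn : 2 ≤ n) :
    -- every ideal of `u_n` is `I_λ` for exactly one `λ ∈ [0, ord (Ω_n)]`
    (∀ J : LieIdeal K (TriDer.u K n),
      ∃! lam : Ordinal.{0}, lam ≤ TriDer.ordOmega n ∧ J = TriDer.idealI K n lam) ∧
    -- `u_n / I_λ ≅ u_n` iff `λ = iω^{n-2}`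
    (∀ lam : Ordinal.{0}, lam ≤ TriDer.ordOmega n →
      (Nonempty (TriDer.u K n ≃ₗ⁅K⁆ (TriDer.u K n ⧸ TriDer.idealI K n lam)) ↔
        ∃ i : ℕ, lam = Ordinal.omega0 ^ (n - 2) * i)) ∧
    -- `u_n / I_λ ≅ u_n / I_μ`
    (∀ lam mu : Ordinal.{0}, lam ≤ TriDer.ordOmega n → mu ≤ TriDer.ordOmega n →
      (Nonempty ((TriDer.u K n ⧸ TriDer.idealI K n lam) ≃ₗ⁅K⁆ (TriDer.u K n ⧸ TriDer.idealI K n mu)) ↔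
        ((∃ (i j : ℕ) (nu : Ordinal.{0}), nu < Ordinal.omega0 ^ (n - 2) ∧
            lam = Ordinal.omega0 ^ (n - 2) * i + nu ∧
            mu = Ordinal.omega0 ^ (n - 2) * j + nu) ∨
          (∃ (s i j : ℕ) (nu : Ordinal.{0}), 2 ≤ s ∧ s ≤ n - 1 ∧
            nu < Ordinal.omega0 ^ (s - 2) ∧
            lam = TriDer.omegaSum s n + Ordinal.omega0 ^ (s - 2) * i + nu ∧
            mu = TriDer.omegaSum s n + Ordinal.omega0 ^ (s - 2) * j + nu) ∨
          (∃ eps : Ordinal.{0}, (eps = 0 ∨ eps = 1) ∧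
            lam = TriDer.omegaSum 1 n + eps ∧ mu = TriDer.omegaSum 1 n + eps)))) := by
  exact ⟨TriDer.existsUnique_eq_idealI, fun _ hl => TriDer.equiv_quot_iff hn hl,
    fun _ _ hl hm => TriDer.quot_equiv_iff hn hl hm⟩
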